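/- Let $K$ be a field with $\operatorname{char} K \neq 2,3$, let $m,n$ be natural numbers, and let $K[x]=K[x_1,\ldots,x_n]$ be the polynomial ring in $n$ variables. Let $H=(H_1,\ldots,H_m)\in K[x]^m$ be a cubic homogeneous polynomial map, i.e. each $H_i$ is zero or homogeneous of degree $3$, let $\mathcal{J}H=\left(\frac{\partial H_i}{\partial x_j}\right)_{m\times n}$ be its Jacobian matrix, and let $\operatorname{rk}\mathcal{J}H$ be the rank of this matrix over the rational function field $K(x)$. If $\operatorname{rk}\mathcal{J}H\le 2$, then $$\operatorname{rk}\mathcal{J}H=\operatorname{trdeg}_K K(H),$$ where $K(H)=K(H_1,\ldots,H_m)\subseteq K(x)$ and $\operatorname{trdeg}_K K(H)$ denotes its transcendence degree over $K$. -/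

import Mathlib

/-- The Jacobian matrix `(∂Hᵢ/∂xⱼ)` of a polynomial map `H ∈ K[x₁,…,xₙ]^m`. -/
noncomputable def jacobianMatrix {K : Type*} [Field K] {m n : ℕ}
    (H : Fin m → MvPolynomial (Fin n) K) :
    Matrix (Fin m) (Fin n) (MvPolynomial (Fin n) K) :=
  Matrix.of fun i j => MvPolynomial.pderiv j (H i)

/-- The rank of the Jacobian matrix, taken over the field of rational functions `K(x₁,…,xₙ)`. -/
noncomputable def jacobianRank {K : Type*} [Field K] {m n : ℕ}
    (H : Fin m → MvPolynomial (Fin n) K) : ℕ :=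
  ((jacobianMatrix H).map
    (algebraMap (MvPolynomial (Fin n) K) (FractionRing (MvPolynomial (Fin n) K)))).rank

/-- The subfield `K(H) = K(H₁,…,Hₘ)` of `K(x₁,…,xₙ)`. -/
noncomputable def fieldGeneratedBy {K : Type*} [Field K] {m n : ℕ}
    (H : Fin m → MvPolynomial (Fin n) K) :
    IntermediateField K (FractionRing (MvPolynomial (Fin n) K)) :=
  IntermediateField.adjoin K (Set.range fun i =>
    algebraMap (MvPolynomial (Fin n) K) (FractionRing (MvPolynomial (Fin n) K)) (H i))

/-- A polynomial map is cubic homogeneous if each component is zero or homogeneous of degree 3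
(the zero polynomial satisfies `IsHomogeneous` in every degree). -/
def IsCubicHomogeneous {K : Type*} [Field K] {m n : ℕ}
    (H : Fin m → MvPolynomial (Fin n) K) : Prop :=
  ∀ i, (H i).IsHomogeneous 3

/-! Both numbers are the maximal size of an independent subfamily of `H`: linearly independent
gradients on one side, algebraically independent forms on the other. It therefore suffices to
compare the two notions for at most three cubic forms.

For at most two forms, independent gradients give independent forms: two algebraically dependent
forms of equal degree have a quotient algebraic over K, and as K[x] is integrally closed this
quotient is a constant. Conversely, the hard case is three cubics f, g, h with dependent gradients
(`not_algebraicIndependent_of_pderiv_dependent`); in positive characteristic the usual Jacobian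
criterion does not apply.

There, a point v with (f ∂ⱼg - g ∂ⱼf)(v) ≠ 0 is chosen, and x ↦ x + (t + l)v is substituted. After
linear combinations of f, g, h and a suitable choice of l, the images are t³ + At + C, yt² + Bt + D
and qt + c, with y ≠ 0 a linear form. For every derivation 𝔇 of K[x] killing y, the determinant
formed by applying ∂/∂t, the identity and 𝔇 to the three images vanishes. Its coefficients in t can
be integrated one after another, because a form of degree at most 4 killed by all such 𝔇 is a
constant times a power of y; this uses char K ≠ 2, 3. Either h becomes 0, or all three lie in K[t,
y], or with a linear form N f = (t + 2N)((t - N)² - ky²), g = y(t + 2N)(t - N - by), h = αy²(t +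
2N), so that fh is a quadratic form in g and h. Each time, all three are algebraic over two
elements. -/

namespace MvPolynomial

variable {K σ : Type*} [Field K]

/-! ### Homogeneous forms and derivations killing a linear form. -/

theorem IsHomogeneous.of_mul_left {y a : MvPolynomial σ K} {d e : ℕ} (hy : y.IsHomogeneous e)
    (hy0 : y ≠ 0) (h : (y * a).IsHomogeneous (e + d)) : a.IsHomogeneous d := by
  have key : ∀ j, j ≠ d → homogeneousComponent j a = 0 := by
    intro j hj
    have h1 : homogeneousComponent (e + j) (y * a) = y * homogeneousComponent j a := by
      conv_lhs => rw [← sum_homogeneousComponent a, Finset.mul_sum, map_sum]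
      have h2 : ∀ i, homogeneousComponent (e + j) (y * homogeneousComponent i a) =
          if i = j then y * homogeneousComponent j a else 0 := by
        intro i
        have h3 : y * homogeneousComponent i a ∈ homogeneousSubmodule σ K (e + i) :=
          hy.mul (homogeneousComponent_isHomogeneous i a)
        rw [homogeneousComponent_of_mem h3]
        by_cases hij : i = j
        · subst hij; simp
        · rw [if_neg hij, if_neg (by omega)]
      rw [Finset.sum_congr rfl fun i _ => h2 i, Finset.sum_ite_eq']
      split_ifs with hmem
      · rfl
      · rw [Finset.mem_range, not_lt] at hmem
        rw [homogeneousComponent_eq_zero _ _ (by omega), mul_zero]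
    have h4 : homogeneousComponent (e + j) (y * a) = 0 := by
      rw [homogeneousComponent_of_mem (show y * a ∈ homogeneousSubmodule σ K (e + d) from h),
        if_neg (by omega)]
    rw [h4] at h1
    exact (mul_eq_zero.mp h1.symm).resolve_left hy0
  obtain rfl | ha0 := eq_or_ne a 0
  · exact isHomogeneous_zero _ _ _
  have : homogeneousComponent d a = a := by
    conv_rhs => rw [← sum_homogeneousComponent a]
    rw [Finset.sum_eq_single_of_mem (s := Finset.range (a.totalDegree + 1)) d]
    · by_contra hd
      refine ha0 ?_
      rw [← sum_homogeneousComponent a]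
      refine Finset.sum_eq_zero fun j hj => key j ?_
      rintro rfl; exact hd hj
    · intro j _ hj; exact key j hj
  rw [← this]; exact homogeneousComponent_isHomogeneous d a

theorem IsHomogeneous.eq_C {a : MvPolynomial σ K} (h : a.IsHomogeneous 0) : ∃ c, a = C c :=
  ⟨_, totalDegree_eq_zero_iff_eq_C.mp (Nat.le_zero.mp h.totalDegree_le)⟩

theorem IsHomogeneous.prime_of_one {y : MvPolynomial σ K} (hy : y.IsHomogeneous 1) (hy0 : y ≠ 0) :
    Prime y := by
  rw [← irreducible_iff_prime]
  refine irreducible_of_totalDegree_eq_one (hy.totalDegree hy0) fun x hx => ?_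
  rw [isUnit_iff_ne_zero]
  rintro rfl
  exact hy0 (by ext i; simpa using hx i)

/-- The derivation `(∂y/∂xᵢ) ∂/∂xⱼ - (∂y/∂xⱼ) ∂/∂xᵢ`, which kills `y`. -/
noncomputable def wedgeDerivation (y : MvPolynomial σ K) (i j : σ) :
    Derivation K (MvPolynomial σ K) (MvPolynomial σ K) :=
  pderiv i y • pderiv j - pderiv j y • pderiv i

theorem wedgeDerivation_apply (y a : MvPolynomial σ K) (i j : σ) :
    wedgeDerivation y i j a = pderiv i y * pderiv j a - pderiv j y * pderiv i a := by
  simp [wedgeDerivation]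

theorem wedgeDerivation_self (y : MvPolynomial σ K) (i j : σ) :
    wedgeDerivation y i j y = 0 := by
  rw [wedgeDerivation_apply]; ring

/-- This is the integration step used throughout: the wedge derivations of y together with Euler's
formula show that y divides a, and the quotient is killed by the same derivations. The degrees met
along the way must be invertible in K. -/
theorem exists_eq_C_mul_pow_of_derivations [Fintype σ] {y : MvPolynomial σ K} (hy : y.IsHomogeneous 1)
    (hy0 : y ≠ 0) (d : ℕ) (hd : ∀ k, 0 < k → k ≤ d → (k : K) ≠ 0) {a : MvPolynomial σ K}
    (ha : a.IsHomogeneous d)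
    (hD : ∀ D : Derivation K (MvPolynomial σ K) (MvPolynomial σ K), D y = 0 → D a = 0) :
    ∃ c : K, a = C c * y ^ d := by
  induction d generalizing a with
  | zero =>
    obtain ⟨c, hc⟩ := ha.eq_C
    exact ⟨c, by simp [hc]⟩
  | succ d ih =>
    have eu := hy.sum_X_mul_pderiv
    obtain ⟨i, hi⟩ : ∃ i, pderiv i y ≠ 0 := by
      by_contra! hcon
      simp [hcon] at eu
      exact hy0 eu.symm
    obtain ⟨u, hu⟩ := (hy.pderiv (i := i)).eq_C
    have hu0 : u ≠ 0 := by rintro rfl; exact hi (by simpa using hu)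
    have hCu : C u * C u⁻¹ = (1 : MvPolynomial σ K) := by rw [← C_mul, mul_inv_cancel₀ hu0, C_1]
    set v : K := ((d + 1 : ℕ) : K)⁻¹
    have hCv : C v * ((d + 1 : ℕ) : MvPolynomial σ K) = 1 := by
      rw [← C_eq_coe_nat, ← C_mul, inv_mul_cancel₀ (hd _ (by omega) le_rfl), C_1]
    -- The relations ∂ᵢy ∂ₖa = ∂ₖy ∂ᵢa, multiplied by xₖ and summed over k, become u(d + 1)a = y ∂ᵢa
    -- by Euler.
    have hab : a = y * (C v * C u⁻¹ * pderiv i a) := by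
      have e1 : ∑ k, X k * pderiv k a = C u⁻¹ * pderiv i a * y := by
        have eu' : y = ∑ k, X k * pderiv k y := by rw [eu]; simp
        conv_rhs => rw [eu', Finset.mul_sum]
        refine Finset.sum_congr rfl fun k _ => ?_
        have := hD _ (wedgeDerivation_self y i k)
        rw [wedgeDerivation_apply, hu] at this
        linear_combination X k * C u⁻¹ * this - X k * pderiv k a * hCu
      rw [ha.sum_X_mul_pderiv, nsmul_eq_mul] at e1
      linear_combination C v * e1 - a * hCv
    set b := C v * C u⁻¹ * pderiv i a
    have hb : b.IsHomogeneous d := by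
      have : (C v * C u⁻¹ : MvPolynomial σ K) = C (v * u⁻¹) := by simp
      simp only [b, this]
      exact (ha.pderiv (i := i)).C_mul _
    obtain ⟨c, hc⟩ := ih (fun k h1 h2 => hd k h1 (by omega)) hb (fun D hDy => by
      have h1 := hD D hDy
      rw [hab, Derivation.leibniz, hDy] at h1
      simpa [hy0] using h1)
    exact ⟨c, by rw [hab, hc]; ring⟩

end MvPolynomial

/-! ### The determinant in t and the normal form of its solutions. -/

/-- The hypothesis is the determinant of ∂/∂t, the identity and 𝔇 applied to t³ + At + C, yt² + Bt +
D, qt + c; primes mark images under 𝔇, with y' = 0. The conclusions are its coefficients from t⁵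
down to 1. -/
theorem Polynomial.coeff_eq_zero_of_det_eq_zero {R : Type*} [CommRing R]
    {y A B C D q c A' B' C' D' q' c' : R}
    (h : (3 * .X ^ 2 + .C A : Polynomial R) *
        ((.X ^ 2 * .C y + .X * .C B + .C D) * (.X * .C q' + .C c')
          - (.X * .C B' + .C D') * (.X * .C q + .C c))
      - (.X ^ 3 + .X * .C A + .C C) *
        ((2 * .X * .C y + .C B) * (.X * .C q' + .C c') - (.X * .C B' + .C D') * .C q)
      + (.X * .C A' + .C C') *
        ((2 * .X * .C y + .C B) * (.X * .C q + .C c)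
          - (.X ^ 2 * .C y + .X * .C B + .C D) * .C q) = 0) :
    y * q' = 0 ∧ y * c' + 2 * B * q' - 2 * B' * q = 0 ∧
    2 * B * c' + 3 * D * q' - 3 * B' * c - 2 * D' * q - A * y * q' + A' * y * q = 0 ∧
    3 * (D * c' - D' * c) - A * y * c' - 2 * y * q' * C + 2 * y * c * A' + y * q * C' = 0 ∧
    A * (D * q' - B' * c) - C * (2 * y * c' + B * q' - B' * q) + A' * (B * c - D * q)
      + 2 * y * c * C' = 0 ∧
    A * (D * c' - D' * c) - C * (B * c' - D' * q) + C' * (B * c - D * q) = 0 := by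
  have key : (.C (y * q') * .X ^ 5 + .C (y * c' + 2 * B * q' - 2 * B' * q) * .X ^ 4
      + .C (2 * B * c' + 3 * D * q' - 3 * B' * c - 2 * D' * q - A * y * q' + A' * y * q) * .X ^ 3
      + .C (3 * (D * c' - D' * c) - A * y * c' - 2 * y * q' * C + 2 * y * c * A' + y * q * C')
        * .X ^ 2
      + .C (A * (D * q' - B' * c) - C * (2 * y * c' + B * q' - B' * q) + A' * (B * c - D * q)
        + 2 * y * c * C') * .X
      + .C (A * (D * c' - D' * c) - C * (B * c' - D' * q) + C' * (B * c - D * q)) :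
        Polynomial R) = 0 := by
    rw [← h]
    simp only [map_add, map_sub, map_mul, map_ofNat]
    ring
  have hc := fun k => congrArg (Polynomial.coeff · k) key
  have h5 := hc 5
  have h4 := hc 4
  have h3 := hc 3
  have h2 := hc 2
  have h1 := hc 1
  have h0 := hc 0
  simp only [Polynomial.coeff_add, Polynomial.coeff_C_mul, Polynomial.coeff_X_pow,
    Polynomial.coeff_X, Polynomial.coeff_C, Polynomial.coeff_zero] at h5 h4 h3 h2 h1 h0
  norm_num at h5 h4 h3 h2 h1 h0
  exact ⟨by linear_combination h5, h4, h3, h2, h1, h0⟩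

namespace MvPolynomial

variable {K σ : Type*} [Field K] [Fintype σ]

/-- The hypotheses `e3` to `e0` are the coefficients of t³, t², t, 1 for q = αy² and c = 2αy(B +
by²), with α ≠ 0 cancelled. The first three are integrated in turn, with constants l, δ, ρ; the last
one decides between the two alternatives. -/
theorem normalForm_of_ne_zero (h2 : (2 : K) ≠ 0) (h3 : (3 : K) ≠ 0)
    {y A B C₀ D₀ : MvPolynomial σ K} (hy : y.IsHomogeneous 1) (hy0 : y ≠ 0)
    (hA : A.IsHomogeneous 2) (hB : B.IsHomogeneous 2) (hC : C₀.IsHomogeneous 3)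
    (hD₀ : D₀.IsHomogeneous 3) (b : K)
    (e3 : ∀ D : Derivation K (MvPolynomial σ K) (MvPolynomial σ K), D y = 0 →
      2 * B * (2 * y * D B) - 3 * D B * (2 * y * (B + C b * y ^ 2)) - 2 * D D₀ * y ^ 2
        + D A * y * y ^ 2 = 0)
    (e2 : ∀ D : Derivation K (MvPolynomial σ K) (MvPolynomial σ K), D y = 0 →
      3 * (D₀ * (2 * y * D B) - D D₀ * (2 * y * (B + C b * y ^ 2))) - A * y * (2 * y * D B)
        + 2 * y * (2 * y * (B + C b * y ^ 2)) * D A + y * y ^ 2 * D C₀ = 0)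
    (e1 : ∀ D : Derivation K (MvPolynomial σ K) (MvPolynomial σ K), D y = 0 →
      A * (-D B * (2 * y * (B + C b * y ^ 2))) - C₀ * (2 * y * (2 * y * D B) - D B * y ^ 2)
        + D A * (B * (2 * y * (B + C b * y ^ 2)) - D₀ * y ^ 2)
        + 2 * y * (2 * y * (B + C b * y ^ 2)) * D C₀ = 0)
    (e0 : ∀ D : Derivation K (MvPolynomial σ K) (MvPolynomial σ K), D y = 0 →
      A * (D₀ * (2 * y * D B) - D D₀ * (2 * y * (B + C b * y ^ 2)))
        - C₀ * (B * (2 * y * D B) - D D₀ * y ^ 2)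
        + D C₀ * (B * (2 * y * (B + C b * y ^ 2)) - D₀ * y ^ 2) = 0) :
    (∃ a₁ a₂ a₃ a₄ : K, A = C a₁ * y ^ 2 ∧ B = C a₂ * y ^ 2 ∧ C₀ = C a₃ * y ^ 3 ∧
      D₀ = C a₄ * y ^ 3) ∨
    ∃ (N : MvPolynomial σ K) (k : K), A = -C k * y ^ 2 - 3 * N ^ 2 ∧ B = y * (N - C b * y) ∧
      C₀ = 2 * N ^ 3 - 2 * C k * y ^ 2 * N ∧ D₀ = -2 * y * N * (N + C b * y) := by
  have hS2 : (2 : MvPolynomial σ K) ≠ 0 := by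
    rw [← map_ofNat (C : K →+* MvPolynomial σ K) 2]; simpa using h2
  have hS3 : (3 : MvPolynomial σ K) ≠ 0 := by
    rw [← map_ofNat (C : K →+* MvPolynomial σ K) 3]; simpa using h3
  have hdeg : ∀ k : ℕ, 0 < k → k ≤ 4 → (k : K) ≠ 0 := by
    intro k hk hk'
    have h4 : (4 : K) ≠ 0 := by
      have : (4 : K) = 2 * 2 := by norm_num
      rw [this]; exact mul_ne_zero h2 h2
    interval_cases k
    · simp
    · exact_mod_cast h2
    · exact_mod_cast h3
    · exact_mod_cast h4
  have hdeg3 : ∀ k : ℕ, 0 < k → k ≤ 3 → (k : K) ≠ 0 := fun k h h' => hdeg k h (by omega)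
  have hdeg1 : ∀ k : ℕ, 0 < k → k ≤ 1 → (k : K) ≠ 0 := fun k h h' => hdeg k h (by omega)
  have hnum : ∀ {p : MvPolynomial σ K} {d : ℕ} (n : ℕ) [n.AtLeastTwo],
      p.IsHomogeneous d → ((OfNat.ofNat n : MvPolynomial σ K) * p).IsHomogeneous d := by
    intro p d n _ hp
    rw [← map_ofNat (C : K →+* MvPolynomial σ K) n]; exact hp.C_mul _
  have hy2 : (y ^ 2).IsHomogeneous 2 := by simpa using hy.pow 2
  have hy3 : (y ^ 3).IsHomogeneous 3 := by simpa using hy.pow 3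
  have hDpow : ∀ (D : Derivation K (MvPolynomial σ K) (MvPolynomial σ K)), D y = 0 → ∀ n : ℕ,
      D (y ^ n) = 0 := by
    intro D hD n; rw [Derivation.leibniz_pow, hD]; simp
  have hDnum : ∀ (D : Derivation K (MvPolynomial σ K) (MvPolynomial σ K)) (n : ℕ)
      [n.AtLeastTwo], D (OfNat.ofNat n : MvPolynomial σ K) = 0 := by
    intro D n _
    rw [← map_ofNat (C : K →+* MvPolynomial σ K) n]; exact derivation_C D _
  -- the coefficient of `t ^ 3`
  obtain ⟨l, hl⟩ := exists_eq_C_mul_pow_of_derivations hy hy0 4 hdeg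
    (a := y ^ 2 * A - 2 * (y * D₀) - B ^ 2 - 6 * (C b * (y ^ 2 * B)))
    ((((hy2.mul hA).sub (hnum 2 (hy.mul hD₀))).sub (hB.pow 2)).sub
      (hnum 6 ((hy2.mul hB).C_mul b))) (fun D hD => by
    have h := e3 D hD
    have : y * D (y ^ 2 * A - 2 * (y * D₀) - B ^ 2 - 6 * (C b * (y ^ 2 * B))) = 0 := by
      simp only [map_sub, Derivation.leibniz, Derivation.leibniz_pow, derivation_C, smul_eq_mul,
        hD, hDnum, nsmul_eq_mul]
      push_cast
      linear_combination h
    exact (mul_eq_zero.mp this).resolve_left hy0)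
  -- In the integrated relation every term except B² is visibly a multiple of y.
  obtain ⟨L, rfl⟩ : y ∣ B := by
    refine (hy.prime_of_one hy0).dvd_of_dvd_pow (n := 2)
      ⟨y * A - 2 * D₀ - 6 * C b * y * B - C l * y ^ 3, ?_⟩
    linear_combination -hl
  have hL : L.IsHomogeneous 1 := hy.of_mul_left hy0 (d := 1) hB
  -- This shift of L is the one for which t + 2N becomes the common factor in the second
  -- alternative.
  obtain ⟨N, rfl⟩ : ∃ N, L = N - C b * y := ⟨L + C b * y, by ring⟩
  have hN : N.IsHomogeneous 1 := by simpa using hL.add (hy.C_mul b)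
  obtain ⟨k, hk⟩ : ∃ k : K, C k = (5 * C b ^ 2 - C l : MvPolynomial σ K) :=
    ⟨5 * b ^ 2 - l, by simp only [map_sub, map_mul, map_pow, map_ofNat]⟩
  have hW : 2 * D₀ = y * (A - N ^ 2 - 4 * C b * y * N + C k * y ^ 2) := by
    refine mul_left_cancel₀ hy0 ?_
    linear_combination -hl - y ^ 4 * hk
  have hW' : ∀ D : Derivation K (MvPolynomial σ K) (MvPolynomial σ K), D y = 0 →
      2 * D D₀ = y * (D A - 2 * N * D N - 4 * C b * y * D N) := by
    intro D hD
    have := congrArg D hW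
    simp only [map_sub, map_add, Derivation.leibniz, Derivation.leibniz_pow, derivation_C,
      smul_eq_mul, hD, hDnum, nsmul_eq_mul] at this
    push_cast at this
    linear_combination this
  have hB' : ∀ D : Derivation K (MvPolynomial σ K) (MvPolynomial σ K), D y = 0 →
      D (y * (N - C b * y)) = y * D N := by
    intro D hD
    simp [Derivation.leibniz, hD]
  -- the coefficient of `t ^ 2`
  obtain ⟨δ, hδ⟩ := exists_eq_C_mul_pow_of_derivations hy hy0 3 hdeg3
    (a := C₀ + A * N + N ^ 3 + 3 * (C k * (y ^ 2 * N)))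
    (((hC.add (hA.mul hN)).add (by simpa using hN.pow 3)).add
      (hnum 3 ((hy2.mul hN).C_mul k))) (fun D hD => by
    have h := e2 D hD
    have : y ^ 3 * D (C₀ + A * N + N ^ 3 + 3 * (C k * (y ^ 2 * N))) = 0 := by
      rw [hB' D hD] at h
      simp only [map_add, Derivation.leibniz, Derivation.leibniz_pow, derivation_C, smul_eq_mul,
        hD, hDnum, nsmul_eq_mul]
      push_cast
      linear_combination h - 3 * y ^ 2 * D N * hW + 3 * y ^ 2 * N * hW' D hD
    exact (mul_eq_zero.mp this).resolve_left (pow_ne_zero 3 hy0))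
  obtain rfl : C₀ = C δ * y ^ 3 - A * N - N ^ 3 - 3 * C k * y ^ 2 * N := by
    linear_combination hδ
  have hC' : ∀ D : Derivation K (MvPolynomial σ K) (MvPolynomial σ K), D y = 0 →
      D (C δ * y ^ 3 - A * N - N ^ 3 - 3 * C k * y ^ 2 * N) =
        - D A * N - A * D N - 3 * N ^ 2 * D N - 3 * C k * y ^ 2 * D N := by
    intro D hD
    simp only [map_sub, Derivation.leibniz, Derivation.leibniz_pow, derivation_C,
      smul_eq_mul, hD, hDnum, nsmul_eq_mul]
    push_cast
    ring
  -- the coefficient of `t`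
  obtain ⟨P, hP⟩ : ∃ P, P = A + 3 * N ^ 2 + C k * y ^ 2 := ⟨_, rfl⟩
  have hPhom : P.IsHomogeneous 2 := by
    rw [hP]; exact (hA.add (hnum 3 (by simpa using hN.pow 2))).add (hy2.C_mul k)
  have hP' : ∀ D : Derivation K (MvPolynomial σ K) (MvPolynomial σ K), D y = 0 →
      D P = D A + 6 * N * D N := by
    intro D hD
    rw [hP]
    simp only [map_add, Derivation.leibniz, Derivation.leibniz_pow, derivation_C,
      smul_eq_mul, hD, hDnum, nsmul_eq_mul]
    push_cast
    ring
  have hPP : ∀ D : Derivation K (MvPolynomial σ K) (MvPolynomial σ K), D y = 0 →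
      P * D P + 6 * C δ * y ^ 3 * D N = 0 := by
    intro D hD
    have h := e1 D hD
    rw [hB' D hD, hC' D hD] at h
    have : y ^ 3 * (P * D P + 6 * C δ * y ^ 3 * D N) = 0 := by
      rw [hP' D hD, hP]
      linear_combination -2 * h - D A * y ^ 2 * hW
    exact (mul_eq_zero.mp this).resolve_left (pow_ne_zero 3 hy0)
  obtain ⟨ρ, hρ⟩ := exists_eq_C_mul_pow_of_derivations hy hy0 4 hdeg
    (a := P ^ 2 + 12 * (C δ * (y ^ 3 * N)))
    ((hPhom.pow 2).add (hnum 12 ((hy3.mul hN).C_mul δ))) (fun D hD => by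
      simp only [map_add, Derivation.leibniz, Derivation.leibniz_pow, derivation_C, smul_eq_mul,
        hD, hDnum, nsmul_eq_mul]
      push_cast
      linear_combination 2 * hPP D hD)
  -- From P² = ρy⁴ - 12δy³N the prime y divides P; after cancelling y² the right side still contains
  -- y, so y divides P a second time.
  obtain ⟨p, hp⟩ : ∃ p : K, P = C p * y ^ 2 := by
    obtain ⟨P₁, rfl⟩ : y ∣ P := by
      refine (hy.prime_of_one hy0).dvd_of_dvd_pow (n := 2)
        ⟨C ρ * y ^ 3 - 12 * C δ * y ^ 2 * N, ?_⟩
      linear_combination hρ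
    have h1 : P₁ ^ 2 = y * (C ρ * y - 12 * C δ * N) :=
      mul_left_cancel₀ (pow_ne_zero 2 hy0) (by linear_combination hρ)
    obtain ⟨P₂, rfl⟩ : y ∣ P₁ := (hy.prime_of_one hy0).dvd_of_dvd_pow (n := 2) ⟨_, h1⟩
    have h0 : P₂.IsHomogeneous 0 := hy.of_mul_left hy0 (d := 0) (hy.of_mul_left hy0 (d := 1) hPhom)
    obtain ⟨p, rfl⟩ := h0.eq_C
    exact ⟨p, by ring⟩
  have hPz : ∀ D : Derivation K (MvPolynomial σ K) (MvPolynomial σ K), D y = 0 → D P = 0 := by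
    intro D hD
    rw [hp, Derivation.leibniz, hDpow D hD]; simp
  have hAeq : A = C p * y ^ 2 - 3 * N ^ 2 - C k * y ^ 2 := by linear_combination hp - hP
  have hδN : ∀ D : Derivation K (MvPolynomial σ K) (MvPolynomial σ K), D y = 0 →
      C δ * D N = 0 := by
    intro D hD
    have h := hPP D hD
    rw [hPz D hD] at h
    have h6 : (2 * 3 * y ^ 3) * (C δ * D N) = 0 := by linear_combination h
    exact (mul_eq_zero.mp h6).resolve_left
      (mul_ne_zero (mul_ne_zero hS2 hS3) (pow_ne_zero 3 hy0))
  -- the constant coefficient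
  have hpN : ∀ D : Derivation K (MvPolynomial σ K) (MvPolynomial σ K), D y = 0 →
      C p ^ 2 * D N = 0 := by
    intro D hD
    have h := e0 D hD
    have hA' : D A = - 6 * N * D N := by linear_combination hPz D hD - hP' D hD
    have hW'' := hW' D hD
    have hδ' := hδN D hD
    rw [hB' D hD, hC' D hD] at h
    rw [hA'] at h hW''
    rw [hAeq] at h
    have hW := hW
    rw [hAeq] at hW
    have : (3 * y ^ 7) * (C p ^ 2 * D N) = 0 := by
      linear_combination 2 * h + 12 * N * y ^ 6 * hδ'
        - ((C p * y ^ 2 - 3 * N ^ 2 - C k * y ^ 2) * (2 * y * (y * D N))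
          - (-(-6 * N * D N) * N - (C p * y ^ 2 - 3 * N ^ 2 - C k * y ^ 2) * D N
            - 3 * N ^ 2 * D N - 3 * C k * y ^ 2 * D N) * y ^ 2) * hW
        - ((C δ * y ^ 3 - (C p * y ^ 2 - 3 * N ^ 2 - C k * y ^ 2) * N - N ^ 3
            - 3 * C k * y ^ 2 * N) * y ^ 2
          - (C p * y ^ 2 - 3 * N ^ 2 - C k * y ^ 2) * (2 * y * (y * N))) * hW''
    exact (mul_eq_zero.mp this).resolve_left (mul_ne_zero hS3 (pow_ne_zero 7 hy0))
  -- If δ or p is nonzero, then N is killed by every 𝔇, hence is a multiple of y, and so all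
  -- coefficients are multiples of powers of y.
  by_cases hc : δ = 0 ∧ p = 0
  · obtain ⟨rfl, rfl⟩ := hc
    rw [C_0] at hAeq ⊢
    refine Or.inr ⟨N, k, by rw [hAeq]; ring, rfl, by rw [hAeq]; ring, mul_left_cancel₀ hS2 ?_⟩
    rw [hW, hAeq]; ring
  · have hNz : ∀ D : Derivation K (MvPolynomial σ K) (MvPolynomial σ K), D y = 0 → D N = 0 := by
      intro D hD
      have h1 := hδN D hD
      have h2 := hpN D hD
      by_contra h0
      simp only [mul_eq_zero, h0, or_false, map_eq_zero, pow_eq_zero_iff, ne_eq,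
        OfNat.ofNat_ne_zero, not_false_eq_true] at h1 h2
      exact hc ⟨h1, h2⟩
    obtain ⟨ν, rfl⟩ := exists_eq_C_mul_pow_of_derivations hy hy0 1 hdeg1 hN hNz
    have hhalf : (2 : MvPolynomial σ K) * C (2⁻¹) = 1 := by
      rw [← map_ofNat (C : K →+* MvPolynomial σ K) 2, ← C_mul, mul_inv_cancel₀ h2, C_1]
    refine Or.inl ⟨p - 3 * ν ^ 2 - k, ν - b, δ - (p - 3 * ν ^ 2 - k) * ν - ν ^ 3 - 3 * k * ν,
      2⁻¹ * (p - 4 * ν ^ 2 - 4 * b * ν), ?_, ?_, ?_, mul_left_cancel₀ hS2 ?_⟩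
    · rw [hAeq]; simp only [map_sub, map_mul, map_pow, map_ofNat]; ring
    · simp only [map_sub]; ring
    · rw [hAeq]; simp only [map_sub, map_mul, map_pow, map_ofNat]; ring
    · rw [hW, hAeq]; simp only [map_sub, map_mul, map_pow, map_ofNat]
      linear_combination
        -(C p - 4 * C ν ^ 2 - 4 * C b * C ν) * y ^ 3 * hhalf

end MvPolynomial

/-! ### Three polynomials in t with vanishing determinant are algebraic over two elements. -/

/-- The elements of `s` are algebraic over a subalgebra with two generators. -/
def AlgebraicOverPair (K : Type*) {R : Type*} [Field K] [CommRing R] [Algebra K R]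
    (s : Set R) : Prop :=
  ∃ a b : R, ∀ z ∈ s, IsAlgebraic (Algebra.adjoin K {a, b}) z

theorem isAlgebraic_of_mul_mem {K R : Type*} [Field K] [CommRing R] [IsDomain R] [Algebra K R]
    {S : Subalgebra K R} {z h : R} (hh : h ∈ S) (h0 : h ≠ 0) (hz : z * h ∈ S) :
    IsAlgebraic S z := by
  refine ⟨.C ⟨h, hh⟩ * .X - .C ⟨z * h, hz⟩, fun hc => h0 ?_, ?_⟩
  · have h1 : (⟨h, hh⟩ : S) = 0 := by simpa using congrArg (Polynomial.coeff · 1) hc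
    exact congrArg Subtype.val h1
  · rw [map_sub, map_mul, Polynomial.aeval_C, Polynomial.aeval_C, Polynomial.aeval_X]
    change h * z - z * h = 0
    ring

theorem isAlgebraic_of_mem {K R : Type*} [Field K] [CommRing R] [IsDomain R] [Algebra K R]
    {S : Subalgebra K R} {z : R} (hz : z ∈ S) : IsAlgebraic S z :=
  isAlgebraic_algebraMap (⟨z, hz⟩ : S)

theorem algebraicOverPair_insert_zero {K R : Type*} [Field K] [CommRing R] [IsDomain R]
    [Algebra K R] (f g : R) : AlgebraicOverPair K {f, g, 0} := by
  refine ⟨f, g, ?_⟩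
  rintro z (rfl | rfl | rfl)
  · exact isAlgebraic_of_mem (Algebra.subset_adjoin (Set.mem_insert _ _))
  · exact isAlgebraic_of_mem (Algebra.subset_adjoin (Set.mem_insert_of_mem _ rfl))
  · exact isAlgebraic_of_mem (Subalgebra.zero_mem _)

namespace MvPolynomial

variable {K σ : Type*} [Field K] [Fintype σ]

theorem algebraicOverPair_of_det_eq_zero (h2 : (2 : K) ≠ 0) (h3 : (3 : K) ≠ 0)
    {y A B C₀ D₀ q c : MvPolynomial σ K} (hy : y.IsHomogeneous 1) (hy0 : y ≠ 0)
    (hA : A.IsHomogeneous 2) (hB : B.IsHomogeneous 2) (hC : C₀.IsHomogeneous 3)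
    (hD₀ : D₀.IsHomogeneous 3) (hq : q.IsHomogeneous 2) (hc : c.IsHomogeneous 3)
    (hdet : ∀ D : Derivation K (MvPolynomial σ K) (MvPolynomial σ K), D y = 0 →
      (3 * .X ^ 2 + .C A : Polynomial (MvPolynomial σ K)) *
        ((.X ^ 2 * .C y + .X * .C B + .C D₀) * (.X * .C (D q) + .C (D c))
          - (.X * .C (D B) + .C (D D₀)) * (.X * .C q + .C c))
      - (.X ^ 3 + .X * .C A + .C C₀) *
        ((2 * .X * .C y + .C B) * (.X * .C (D q) + .C (D c))
          - (.X * .C (D B) + .C (D D₀)) * .C q)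
      + (.X * .C (D A) + .C (D C₀)) *
        ((2 * .X * .C y + .C B) * (.X * .C q + .C c)
          - (.X ^ 2 * .C y + .X * .C B + .C D₀) * .C q) = 0) :
    AlgebraicOverPair K ({Polynomial.X ^ 3 + Polynomial.X * Polynomial.C A + Polynomial.C C₀,
      Polynomial.X ^ 2 * Polynomial.C y + Polynomial.X * Polynomial.C B + Polynomial.C D₀,
      Polynomial.X * Polynomial.C q + Polynomial.C c} : Set (Polynomial (MvPolynomial σ K))) := by
  have hS2 : (2 : MvPolynomial σ K) ≠ 0 := by
    rw [← map_ofNat (C : K →+* MvPolynomial σ K) 2]; simpa using h2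
  have hS3 : (3 : MvPolynomial σ K) ≠ 0 := by
    rw [← map_ofNat (C : K →+* MvPolynomial σ K) 3]; simpa using h3
  have hdeg : ∀ k : ℕ, 0 < k → k ≤ 3 → (k : K) ≠ 0 := by
    intro k hk hk'
    interval_cases k
    · simp
    · exact_mod_cast h2
    · exact_mod_cast h3
  have hdeg2 : ∀ k : ℕ, 0 < k → k ≤ 2 → (k : K) ≠ 0 := fun k h h' => hdeg k h (by omega)
  -- The degenerate outcome: all three polynomials lie in K[t, y].
  have binary : ∀ a₁ a₂ a₃ a₄ a₅ a₆ : K, A = C a₁ * y ^ 2 → B = C a₂ * y ^ 2 →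
      C₀ = C a₃ * y ^ 3 → D₀ = C a₄ * y ^ 3 → q = C a₅ * y ^ 2 → c = C a₆ * y ^ 3 →
      AlgebraicOverPair K ({Polynomial.X ^ 3 + Polynomial.X * Polynomial.C A + Polynomial.C C₀,
        Polynomial.X ^ 2 * Polynomial.C y + Polynomial.X * Polynomial.C B + Polynomial.C D₀,
        Polynomial.X * Polynomial.C q + Polynomial.C c} : Set (Polynomial (MvPolynomial σ K))) := by
    rintro a₁ a₂ a₃ a₄ a₅ a₆ rfl rfl rfl rfl rfl rfl
    refine ⟨.X, .C y, ?_⟩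
    set S := Algebra.adjoin K ({.X, .C y} : Set (Polynomial (MvPolynomial σ K)))
    have hX : .X ∈ S := Algebra.subset_adjoin (by simp)
    have hyS : .C y ∈ S := Algebra.subset_adjoin (by simp)
    have hyn : ∀ (a : K) (n : ℕ), .C (C a * y ^ n) ∈ S := by
      intro a n
      rw [Polynomial.C_mul, Polynomial.C_pow]
      exact S.mul_mem (S.algebraMap_mem a) (S.pow_mem hyS n)
    rintro z (rfl | rfl | rfl) <;> refine isAlgebraic_of_mem ?_
    · exact S.add_mem (S.add_mem (S.pow_mem hX 3) (S.mul_mem hX (hyn _ _))) (hyn _ _)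
    · exact S.add_mem (S.add_mem (S.mul_mem (S.pow_mem hX 2) hyS) (S.mul_mem hX (hyn _ _)))
        (hyn _ _)
    · exact S.add_mem (S.mul_mem hX (hyn _ _)) (hyn _ _)
  have hcoeff := fun D hD => Polynomial.coeff_eq_zero_of_det_eq_zero (hdet D hD)
  obtain ⟨α, hα⟩ := exists_eq_C_mul_pow_of_derivations hy hy0 2 hdeg2 hq fun D hD =>
    (mul_eq_zero.mp (hcoeff D hD).1).resolve_left hy0
  have hq' : ∀ D : Derivation K (MvPolynomial σ K) (MvPolynomial σ K), D y = 0 → D q = 0 := by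
    intro D hD
    rw [hα]; simp [Derivation.leibniz, hD]
  have hc' : ∀ D : Derivation K (MvPolynomial σ K) (MvPolynomial σ K), D y = 0 →
      D c = 2 * C α * y * D B := by
    intro D hD
    refine mul_left_cancel₀ hy0 ?_
    have := (hcoeff D hD).2.1
    rw [hq' D hD, hα] at this
    linear_combination this
  obtain ⟨β, hβ⟩ := exists_eq_C_mul_pow_of_derivations hy hy0 3 hdeg
    (a := c - C (2 * α) * (y * B)) (hc.sub ((hy.mul hB).C_mul _)) fun D hD => by
      rw [map_sub, hc' D hD]
      simp only [Derivation.leibniz, derivation_C, smul_eq_mul, hD]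
      rw [map_mul, map_ofNat]
      ring
  rw [map_mul, map_ofNat] at hβ
  have hcc : c = 2 * C α * y * B + C β * y ^ 3 := by linear_combination hβ
  -- If α = 0 then h = βy³ has no t. For β ≠ 0 the coefficients of t³, t², t, 1 successively kill
  -- 𝔇B, express 𝔇D₀ and 𝔇C₀ through 𝔇A, and kill 𝔇A.
  by_cases hα0 : α = 0
  · subst hα0
    simp only [C_0, zero_mul, mul_zero, zero_add] at hα hcc hc'
    by_cases hβ0 : β = 0
    · have hz : (.X * .C q + .C c : Polynomial (MvPolynomial σ K)) = 0 := by
        rw [hα, hcc, hβ0]; simp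
      rw [hz]
      exact algebraicOverPair_insert_zero _ _
    have hc0 : c ≠ 0 := by
      rw [hcc]; exact mul_ne_zero (by simpa using hβ0) (pow_ne_zero 3 hy0)
    have hB' : ∀ D : Derivation K (MvPolynomial σ K) (MvPolynomial σ K), D y = 0 → D B = 0 := by
      intro D hD
      have := (hcoeff D hD).2.2.1
      rw [hc' D hD, hq' D hD, hα] at this
      have h6 : 3 * c * D B = 0 := by linear_combination -this
      exact (mul_eq_zero.mp h6).resolve_left (mul_ne_zero hS3 hc0)
    obtain ⟨b, hb⟩ := exists_eq_C_mul_pow_of_derivations hy hy0 2 hdeg2 hB hB'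
    have hD' : ∀ D : Derivation K (MvPolynomial σ K) (MvPolynomial σ K), D y = 0 →
        3 * D D₀ = 2 * y * D A := by
      intro D hD
      have := (hcoeff D hD).2.2.2.1
      rw [hc' D hD, hq' D hD, hα] at this
      refine mul_left_cancel₀ hc0 ?_
      linear_combination -this
    have hC' : ∀ D : Derivation K (MvPolynomial σ K) (MvPolynomial σ K), D y = 0 →
        2 * D C₀ = - C b * y * D A := by
      intro D hD
      have := (hcoeff D hD).2.2.2.2.1
      rw [hc' D hD, hq' D hD, hα, hB' D hD, hb] at this
      refine mul_left_cancel₀ (mul_ne_zero hy0 hc0) ?_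
      linear_combination this
    have hA' : ∀ D : Derivation K (MvPolynomial σ K) (MvPolynomial σ K), D y = 0 → D A = 0 := by
      intro D hD
      have := (hcoeff D hD).2.2.2.2.2
      rw [hc' D hD, hα, hb] at this
      -- Eliminating 𝔇D₀ and 𝔇C₀ leaves this product; if its last factor vanishes, applying 𝔇 to
      -- that factor gives 4𝔇A = 0.
      have h6 : c * y * (D A * (4 * A + 3 * C b ^ 2 * y ^ 2)) = 0 := by
        linear_combination -6 * this - 2 * A * c * hD' D hD + 3 * C b * y ^ 2 * c * hC' D hD
      rcases mul_eq_zero.mp ((mul_eq_zero.mp h6).resolve_left (mul_ne_zero hc0 hy0)) with h7 | h7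
      · exact h7
      · have h8 := congrArg D h7
        rw [← map_ofNat (C : K →+* MvPolynomial σ K) 4,
          ← map_ofNat (C : K →+* MvPolynomial σ K) 3, ← C_pow] at h8
        simp only [map_add, Derivation.leibniz, derivation_C, Derivation.leibniz_pow, hD,
          smul_eq_mul, smul_zero, mul_zero, add_zero, map_zero] at h8
        have h4 : (4 : K) ≠ 0 := by
          have : (4 : K) = 2 * 2 := by norm_num
          rw [this]; exact mul_ne_zero h2 h2
        exact (mul_eq_zero.mp h8).resolve_left fun h => h4 (C_eq_zero.mp h)
    obtain ⟨a, ha⟩ := exists_eq_C_mul_pow_of_derivations hy hy0 2 hdeg2 hA hA'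
    obtain ⟨d, hd⟩ := exists_eq_C_mul_pow_of_derivations hy hy0 3 hdeg hD₀ fun D hD => by
      have := hD' D hD
      rw [hA' D hD, mul_zero] at this
      exact (mul_eq_zero.mp this).resolve_left hS3
    obtain ⟨e, he⟩ := exists_eq_C_mul_pow_of_derivations hy hy0 3 hdeg hC fun D hD => by
      have := hC' D hD
      rw [hA' D hD, mul_zero] at this
      exact (mul_eq_zero.mp this).resolve_left hS2
    exact binary a b e d 0 β ha hb he hd (by simp [hα]) hcc
  · have hCα : (C α : MvPolynomial σ K) ≠ 0 := by rwa [ne_eq, C_eq_zero]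
    obtain ⟨b, hb⟩ : ∃ b : K, C β = (2 * C α * C b : MvPolynomial σ K) :=
      ⟨β * (2 * α)⁻¹, by
        rw [← map_ofNat (C : K →+* MvPolynomial σ K) 2, ← C_mul, ← C_mul]
        congr 1; field_simp⟩
    have hcb : c = C α * (2 * y * (B + C b * y ^ 2)) := by rw [hcc, hb]; ring
    rcases normalForm_of_ne_zero h2 h3 hy hy0 hA hB hC hD₀ b
      (fun D hD => by
        have := (hcoeff D hD).2.2.1
        rw [hc' D hD, hq' D hD, hcb, hα] at this
        refine mul_left_cancel₀ hCα ?_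
        linear_combination this)
      (fun D hD => by
        have := (hcoeff D hD).2.2.2.1
        rw [hc' D hD, hq' D hD, hcb, hα] at this
        refine mul_left_cancel₀ hCα ?_
        linear_combination this)
      (fun D hD => by
        have := (hcoeff D hD).2.2.2.2.1
        rw [hc' D hD, hq' D hD, hcb, hα] at this
        refine mul_left_cancel₀ hCα ?_
        linear_combination this)
      (fun D hD => by
        have := (hcoeff D hD).2.2.2.2.2
        rw [hc' D hD, hcb, hα] at this
        refine mul_left_cancel₀ hCα ?_
        linear_combination this) with ⟨a₁, a₂, a₃, a₄, h₁, h₂, h₃, h₄⟩ | ⟨N, k, h₁, h₂, h₃, h₄⟩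
    · refine binary a₁ a₂ a₃ a₄ α (2 * α * a₂ + β) h₁ h₂ h₃ h₄ hα ?_
      rw [hcc, h₂]; simp only [map_add, map_mul, map_ofNat]; ring
    · set f : Polynomial (MvPolynomial σ K) := .X ^ 3 + .X * .C A + .C C₀ with hf
      set g : Polynomial (MvPolynomial σ K) := .X ^ 2 * .C y + .X * .C B + .C D₀ with hg
      set h : Polynomial (MvPolynomial σ K) := .X * .C q + .C c with hh
      have h0 : h ≠ 0 := by
        intro h0
        have hq0 : q = 0 := by
          simpa [hh, Polynomial.coeff_C] using congrArg (Polynomial.coeff · 1) h0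
        rw [hα] at hq0
        exact mul_ne_zero hCα (pow_ne_zero 2 hy0) hq0
      refine ⟨g, h, ?_⟩
      have hgS : g ∈ Algebra.adjoin K {g, h} := Algebra.subset_adjoin (by simp)
      have hhS : h ∈ Algebra.adjoin K {g, h} := Algebra.subset_adjoin (by simp)
      rintro z (rfl | rfl | rfl)
      · refine isAlgebraic_of_mul_mem hhS h0 ?_
        -- With h = αh' and h' = y²(t + 2N), one has g + bh' = y(t + 2N)(t - N) and f = (t + 2N)((t
        -- - N)² - ky²), so fh' = (g + bh')² - kh'².
        have : f * h = algebraMap K _ α * (g + algebraMap K _ (b * α⁻¹) * h) ^ 2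
            - algebraMap K _ (k * α⁻¹) * h ^ 2 := by
          have hi : (Polynomial.C (C α) : Polynomial (MvPolynomial σ K)) *
              Polynomial.C (C α⁻¹) = 1 := by
            rw [← Polynomial.C_mul, ← C_mul, mul_inv_cancel₀ hα0, C_1, Polynomial.C_1]
          have hm : ∀ a : K, algebraMap K (Polynomial (MvPolynomial σ K)) a =
            Polynomial.C (C a) := fun a => rfl
          obtain ⟨h', hh'⟩ : ∃ h' : Polynomial (MvPolynomial σ K), h' =
            .C (y ^ 2) * (.X + 2 * .C N) := ⟨_, rfl⟩
          have hheq : h = Polynomial.C (C α) * h' := by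
            rw [hh, hh', hα, hcb, h₂]
            simp only [map_add, map_mul, map_pow, map_sub, map_ofNat]
            ring
          have e : f * h' = (g + Polynomial.C (C b) * h') ^ 2 - Polynomial.C (C k) * h' ^ 2 := by
            rw [hf, hg, hh', h₁, h₂, h₃, h₄]
            simp only [map_add, map_mul, map_pow, map_sub, map_ofNat, map_neg]
            ring
          have e1 : Polynomial.C (C (b * α⁻¹)) * h = Polynomial.C (C b) * h' := by
            rw [hheq, C_mul, Polynomial.C_mul]
            linear_combination Polynomial.C (C b) * h' * hi
          rw [hm, hm, hm, e1, C_mul, Polynomial.C_mul, hheq]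
          linear_combination Polynomial.C (C α) * e
            + Polynomial.C (C k) * Polynomial.C (C α) * h' ^ 2 * hi
        rw [this]
        exact Subalgebra.sub_mem _ (Subalgebra.mul_mem _ (Subalgebra.algebraMap_mem _ _)
          (Subalgebra.pow_mem _ (Subalgebra.add_mem _ hgS
            (Subalgebra.mul_mem _ (Subalgebra.algebraMap_mem _ _) hhS)) _))
          (Subalgebra.mul_mem _ (Subalgebra.algebraMap_mem _ _) (Subalgebra.pow_mem _ hhS _))
      · exact isAlgebraic_of_mem hgS
      · exact isAlgebraic_of_mem hhS

end MvPolynomial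

/-! ### The substitution x ↦ x + (t + l)v and its coefficients in t. -/

namespace MvPolynomial

variable {K σ : Type*} [Field K]

/-- By this chain rule, a linear relation among gradients carries over to every derivation of the
target ring. -/
theorem derivation_algHom_eq_sum [Fintype σ] {R : Type*} [CommRing R] [Algebra K R]
    (φ : MvPolynomial σ K →ₐ[K] R) (D : Derivation K R R) (f : MvPolynomial σ K) :
    D (φ f) = ∑ i, φ (pderiv i f) * D (φ (X i)) := by
  classical
  induction f using MvPolynomial.induction_on with
  | C a =>
    rw [← algebraMap_eq, AlgHom.commutes, Derivation.map_algebraMap]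
    simp [algebraMap_eq]
  | add p q hp hq => simp [hp, hq, add_mul, Finset.sum_add_distrib]
  | mul_X p j hp =>
    simp only [map_mul, Derivation.leibniz, hp, smul_eq_mul, pderiv_X, map_add, add_mul,
      Finset.sum_add_distrib]
    congr 1
    · rw [Finset.sum_eq_single j]
      · simp
      · intro i _ hij; simp [Pi.single_eq_of_ne (Ne.symm hij)]
      · simp
    · rw [Finset.mul_sum]
      exact Finset.sum_congr rfl fun i _ => by ring

/-- The extension of a derivation to univariate polynomials, acting on the coefficients. -/
noncomputable def _root_.Derivation.onCoeffs {S : Type*} [CommRing S] [Algebra K S]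
    (D : Derivation K S S) : Derivation K (Polynomial S) (Polynomial S) :=
  (PolynomialModule.equivPolynomialSelf (R := S)).toLinearMap.compDer D.mapCoeffs

theorem _root_.Derivation.coeff_onCoeffs {S : Type*} [CommRing S] [Algebra K S]
    (D : Derivation K S S) (p : Polynomial S) (k : ℕ) :
    (D.onCoeffs p).coeff k = D (p.coeff k) := rfl

theorem _root_.Derivation.onCoeffs_X {S : Type*} [CommRing S] [Algebra K S]
    (D : Derivation K S S) : D.onCoeffs .X = 0 := by
  ext k
  rw [Derivation.coeff_onCoeffs, Polynomial.coeff_X]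
  split_ifs <;> simp

theorem _root_.Derivation.onCoeffs_C {S : Type*} [CommRing S] [Algebra K S]
    (D : Derivation K S S) (a : S) : D.onCoeffs (.C a) = .C (D a) := by
  ext k
  rw [Derivation.coeff_onCoeffs, Polynomial.coeff_C, Polynomial.coeff_C]
  split_ifs <;> simp

/-- The substitution `x ↦ x + (t + l) v`. -/
noncomputable def lineShift (v : σ → K) (l : MvPolynomial σ K) :
    MvPolynomial σ K →ₐ[K] Polynomial (MvPolynomial σ K) :=
  aeval fun i => .C (X i) + .C (C (v i)) * (.X + .C l)

theorem lineShift_X (v : σ → K) (l : MvPolynomial σ K) (i : σ) :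
    lineShift v l (X i) = .C (X i) + .C (C (v i)) * (.X + .C l) := by simp [lineShift]

/-- Setting t = -l undoes the substitution. -/
theorem lineShift_injective (v : σ → K) (l : MvPolynomial σ K) :
    Function.Injective (lineShift v l) := by
  have h : ((Polynomial.aeval (-l) : Polynomial (MvPolynomial σ K) →ₐ[MvPolynomial σ K]
      MvPolynomial σ K).restrictScalars K).comp (lineShift v l) = AlgHom.id K _ := by
    ext i : 1
    simp [lineShift_X]
  intro a b hab
  have := congrArg ((Polynomial.aeval (-l) : Polynomial (MvPolynomial σ K) →ₐ[MvPolynomial σ K]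
      MvPolynomial σ K).restrictScalars K) hab
  rwa [← AlgHom.comp_apply, ← AlgHom.comp_apply, h] at this

/-- With t regarded as one more variable `none`, each xᵢ is replaced by a linear form. -/
theorem optionEquivLeft_symm_lineShift_isHomogeneous [Fintype σ] (v : σ → K) {l f : MvPolynomial σ K} {d : ℕ}
    (hl : l.IsHomogeneous 1) (hf : f.IsHomogeneous d) :
    ((optionEquivLeft K σ).symm (lineShift v l f)).IsHomogeneous d := by
  have h : ((optionEquivLeft K σ).symm : _ →ₐ[K] _).comp (lineShift v l) =
      aeval fun i => X (some i) + C (v i) * (X none + rename some l) := by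
    ext i : 1
    simp [lineShift_X, optionEquivLeft_symm_apply, Polynomial.aevalTower_C]
  have h' := DFunLike.congr_fun h f
  change (optionEquivLeft K σ).symm (lineShift v l f) = _ at h'
  rw [h']
  have := hf.aeval (fun i => X (some i) + C (v i) * (X none + rename some l)) (n := 1)
    (fun i => (isHomogeneous_X _ _).add
      (((isHomogeneous_X _ _).add hl.rename_isHomogeneous).C_mul _))
  simpa using this

theorem lineShift_coeff_isHomogeneous [Fintype σ] (v : σ → K) {l f : MvPolynomial σ K} {d : ℕ}
    (hl : l.IsHomogeneous 1) (hf : f.IsHomogeneous d) {i j : ℕ} (hij : i + j = d) :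
    ((lineShift v l f).coeff i).IsHomogeneous j :=
  IsHomogeneous.coeff_isHomogeneous_of_optionEquivLeft_symm
    (optionEquivLeft_symm_lineShift_isHomogeneous v hl hf) i j hij

theorem lineShift_coeff_eq_zero [Fintype σ] (v : σ → K) {l f : MvPolynomial σ K} {d : ℕ}
    (hl : l.IsHomogeneous 1) (hf : f.IsHomogeneous d) {i : ℕ} (hi : d < i) :
    (lineShift v l f).coeff i = 0 := by
  refine Polynomial.coeff_eq_zero_of_natDegree_lt (lt_of_le_of_lt ?_ hi)
  rw [← (optionEquivLeft K σ).apply_symm_apply (lineShift v l f), natDegree_optionEquivLeft]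
  exact (degreeOf_le_totalDegree _ _).trans
    (optionEquivLeft_symm_lineShift_isHomogeneous v hl hf).totalDegree_le

/-- The top coefficient is a constant, and the lower ones have positive degree. Taking constant
terms of all coefficients and then t = 1 isolates it, and this composite is evaluation at v. -/
theorem lineShift_coeff_top [Fintype σ] (v : σ → K) {l f : MvPolynomial σ K} {d : ℕ}
    (hl : l.IsHomogeneous 1) (hf : f.IsHomogeneous d) :
    (lineShift v l f).coeff d = C (eval v f) := by
  obtain ⟨c, hc⟩ := (lineShift_coeff_isHomogeneous v hl hf (i := d) (j := 0) rfl).eq_C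
  rw [hc]
  have h0 : ∀ {p : MvPolynomial σ K} {j : ℕ}, p.IsHomogeneous j → 0 < j →
      constantCoeff p = 0 := by
    intro p j hp hj
    rw [constantCoeff_eq]
    exact hp.coeff_eq_zero (by simpa using hj.ne)
  have h1 : (lineShift v l f).map constantCoeff = .C c * .X ^ d := by
    ext k
    rw [Polynomial.coeff_map, Polynomial.coeff_C_mul_X_pow]
    rcases lt_trichotomy k d with hk | rfl | hk
    · rw [if_neg hk.ne, h0 (lineShift_coeff_isHomogeneous v hl hf (Nat.add_sub_cancel' hk.le))
        (by omega)]
    · rw [hc]; simp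
    · rw [if_neg hk.ne', lineShift_coeff_eq_zero v hl hf hk, map_zero]
  have h2 : ((Polynomial.evalRingHom (1 : K)).comp (Polynomial.mapRingHom constantCoeff)).comp
      (lineShift v l).toRingHom = eval v := by
    ext i
    · simp [lineShift]
    · simp [lineShift_X, h0 hl]
  have h3 := congrArg (Polynomial.eval 1) h1
  have h4 := DFunLike.congr_fun h2 f
  change ((lineShift v l f).map constantCoeff).eval 1 = _ at h4
  rw [← h4, h3]
  simp

/-- This coefficient is a linear form, so Euler recovers it from its partial derivatives; the chain
rule reduces these to top coefficients of the ∂ᵢf. The term 3f(v)l is what allows l to remove the t²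
term. -/
theorem lineShift_coeff_two [Fintype σ] (v : σ → K) {l f : MvPolynomial σ K}
    (hl : l.IsHomogeneous 1) (hf : f.IsHomogeneous 3) :
    (lineShift v l f).coeff 2 =
      ∑ j, C (eval v (pderiv j f)) * X j + 3 * C (eval v f) * l := by
  classical
  have hD : ∀ j, pderiv j ((lineShift v l f).coeff 2) =
      C (eval v (pderiv j f)) + 3 * C (eval v f) * pderiv j l := by
    intro j
    have h1 := congrArg (Polynomial.coeff · 2)
      (derivation_algHom_eq_sum (lineShift v l) (pderiv j : Derivation K _ _).onCoeffs f)
    have hX : ∀ i, (pderiv j : Derivation K _ _).onCoeffs (lineShift v l (X i)) =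
        .C (pderiv j (X i) + C (v i) * pderiv j l) := by
      intro i
      rw [lineShift_X, map_add, Derivation.leibniz, map_add]
      simp only [Derivation.onCoeffs_C, Derivation.onCoeffs_X, derivation_C, smul_eq_mul]
      simp
    simp only [Derivation.coeff_onCoeffs, hX, Polynomial.finsetSum_coeff,
      Polynomial.coeff_mul_C] at h1
    rw [h1]
    have h2 : ∀ i, (lineShift v l (pderiv i f)).coeff 2 = C (eval v (pderiv i f)) :=
      fun i => lineShift_coeff_top v hl hf.pderiv
    have h3 : ∑ i, eval v (pderiv i f) * v i = 3 * eval v f := by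
      have := congrArg (eval v) hf.sum_X_mul_pderiv
      simpa [mul_comm] using this
    have h4 := congrArg (C : K → MvPolynomial σ K) h3
    simp only [map_sum, map_mul, map_ofNat] at h4
    rw [← h4]
    simp only [h2, mul_add, Finset.sum_add_distrib, Finset.sum_mul, mul_assoc]
    congr 1
    rw [Finset.sum_eq_single j]
    · simp
    · intro i _ hij; simp [pderiv_X_of_ne hij]
    · simp
  have e1 := (lineShift_coeff_isHomogeneous v hl hf (i := 2) (j := 1) rfl).sum_X_mul_pderiv
  have e2 := hl.sum_X_mul_pderiv
  rw [one_smul] at e1 e2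
  rw [← e1]
  conv_rhs => rw [← e2, Finset.mul_sum, ← Finset.sum_add_distrib]
  refine Finset.sum_congr rfl fun j _ => ?_
  rw [hD]; ring

theorem lineShift_eq_of_isHomogeneous_three [Fintype σ] (v : σ → K) {l f : MvPolynomial σ K}
    (hl : l.IsHomogeneous 1) (hf : f.IsHomogeneous 3) :
    lineShift v l f = .X ^ 3 * .C (C (eval v f))
      + .X ^ 2 * .C (∑ j, C (eval v (pderiv j f)) * X j + 3 * C (eval v f) * l)
      + .X * .C ((lineShift v l f).coeff 1) + .C ((lineShift v l f).coeff 0) := by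
  rw [← lineShift_coeff_two v hl hf, ← lineShift_coeff_top v hl hf]
  ext1 k
  match k with
  | 0 => simp
  | 1 => simp [Polynomial.coeff_X_pow, Polynomial.coeff_C]
  | 2 => simp [Polynomial.coeff_X_pow]
  | 3 => simp [Polynomial.coeff_X_pow]
  | k + 4 =>
    rw [lineShift_coeff_eq_zero v hl hf (by omega)]
    simp

end MvPolynomial

/-! ### Dependent rows, the size of K, and centring at a point. -/

theorem det_eq_zero_of_dependent_rows {R : Type*} [CommRing R] [IsDomain R]
    {a₁ a₂ a₃ b₁ b₂ b₃ c₁ c₂ c₃ p q r : R} (hne : p ≠ 0 ∨ q ≠ 0 ∨ r ≠ 0)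
    (h₁ : p * a₁ + q * b₁ + r * c₁ = 0) (h₂ : p * a₂ + q * b₂ + r * c₂ = 0)
    (h₃ : p * a₃ + q * b₃ + r * c₃ = 0) :
    a₁ * (b₂ * c₃ - b₃ * c₂) - a₂ * (b₁ * c₃ - b₃ * c₁) + a₃ * (b₁ * c₂ - b₂ * c₁) = 0 := by
  rcases hne with h | h | h <;> refine (mul_eq_zero.mp ?_).resolve_left h
  · linear_combination (b₂ * c₃ - b₃ * c₂) * h₁ - (b₁ * c₃ - b₃ * c₁) * h₂
      + (b₁ * c₂ - b₂ * c₁) * h₃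
  · linear_combination (c₂ * a₃ - c₃ * a₂) * h₁ - (c₁ * a₃ - c₃ * a₁) * h₂
      + (c₁ * a₂ - c₂ * a₁) * h₃
  · linear_combination (a₂ * b₃ - a₃ * b₂) * h₁ - (a₁ * b₃ - a₃ * b₁) * h₂
      + (a₁ * b₂ - a₂ * b₁) * h₃

/-- The number 5 is the degree of f ∂ⱼg - g ∂ⱼf, which must have a nonzero value at some point. -/
theorem natCast_le_card_of_ne_zero {K : Type*} [Field K] (h2 : (2 : K) ≠ 0) (h3 : (3 : K) ≠ 0) :
    ((5 : ℕ) : Cardinal) ≤ Cardinal.mk K := by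
  have h4 : (4 : K) ≠ 0 := by
    have : (4 : K) = 2 * 2 := by norm_num
    rw [this]; exact mul_ne_zero h2 h2
  have hinj : Function.Injective (fun i : Fin 5 => ((i : ℕ) : K)) := by
    have key : ∀ i j : Fin 5, i < j → ((i : ℕ) : K) ≠ ((j : ℕ) : K) := by
      intro i j hij h
      have hd : (((j : ℕ) - (i : ℕ) : ℕ) : K) = 0 := by
        rw [Nat.cast_sub (le_of_lt hij), h, sub_self]
      have h1 : 0 < (j : ℕ) - (i : ℕ) := Nat.sub_pos_of_lt hij
      have h5 : (j : ℕ) - (i : ℕ) ≤ 4 := by omega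
      generalize (j : ℕ) - (i : ℕ) = k at hd h1 h5
      interval_cases k
      · simp at hd
      · exact h2 (by exact_mod_cast hd)
      · exact h3 (by exact_mod_cast hd)
      · exact h4 (by exact_mod_cast hd)
    intro i j hij
    rcases lt_trichotomy i j with h | h | h
    · exact absurd hij (key i j h)
    · exact h
    · exact absurd hij.symm (key j i h)
  simpa using Cardinal.mk_le_of_injective (Function.Injective.comp hinj ULift.down_injective)

namespace MvPolynomial

variable {K σ : Type*} [Field K] [Fintype σ]

/-- The linear form `-(1/3) ∑ ⱼ (∂f/∂xⱼ)(v) xⱼ`, which centres `f` at `v` when `f(v) = 1`. -/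
noncomputable def centre (v : σ → K) (f : MvPolynomial σ K) : MvPolynomial σ K :=
  C (-(3 : K)⁻¹) * ∑ j, C (eval v (pderiv j f)) * X j

theorem isHomogeneous_sum_C_mul_X (a : σ → K) :
    (∑ j, C (a j) * X j : MvPolynomial σ K).IsHomogeneous 1 :=
  IsHomogeneous.sum _ _ _ fun _ _ => isHomogeneous_C_mul_X _ _

theorem isHomogeneous_centre (v : σ → K) (f : MvPolynomial σ K) : (centre v f).IsHomogeneous 1 :=
  (isHomogeneous_sum_C_mul_X _).C_mul _

theorem lineShift_centre (h3 : (3 : K) ≠ 0) {v : σ → K} {f : MvPolynomial σ K}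
    (hf : f.IsHomogeneous 3) (hv : eval v f = 1) :
    lineShift v (centre v f) f = .X ^ 3 + .X * .C ((lineShift v (centre v f) f).coeff 1)
      + .C ((lineShift v (centre v f) f).coeff 0) := by
  have hc : (3 : MvPolynomial σ K) * C (-(3 : K)⁻¹) = -1 := by
    rw [← map_ofNat (C : K →+* MvPolynomial σ K) 3, ← C_mul, mul_neg, mul_inv_cancel₀ h3]; simp
  have : ∑ j, C (eval v (pderiv j f)) * X j + 3 * C (eval v f) * centre v f = 0 := by
    rw [hv, C_1, centre]
    linear_combination (∑ j, C (eval v (pderiv j f)) * X j) * hc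
  conv_lhs => rw [lineShift_eq_of_isHomogeneous_three v
    (isHomogeneous_centre v f) hf, this, hv]
  simp

theorem lineShift_centre_of_eval_eq_zero {v : σ → K} {f g : MvPolynomial σ K}
    (hg : g.IsHomogeneous 3) (hv : eval v g = 0) :
    lineShift v (centre v f) g = .X ^ 2 * .C (∑ j, C (eval v (pderiv j g)) * X j)
      + .X * .C ((lineShift v (centre v f) g).coeff 1)
      + .C ((lineShift v (centre v f) g).coeff 0) := by
  conv_lhs => rw [lineShift_eq_of_isHomogeneous_three v
    (isHomogeneous_centre v f) hg, hv]
  simp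

theorem sum_C_mul_X_eq_zero {a : σ → K} (h : (∑ j, C (a j) * X j : MvPolynomial σ K) = 0) (i : σ) :
    a i = 0 := by
  classical
  have := congrArg (pderiv i) h
  simp only [map_sum, pderiv_C_mul, pderiv_X, map_zero] at this
  rw [Finset.sum_eq_single i] at this
  · simpa using this
  · intro j _ hj; simp [Pi.single_eq_of_ne hj]
  · simp

/-- Let f(v) ≠ 0, and subtract from g the multiple of f that makes it vanish at v. After centring, F
= t³ + At + E and G = yt² + Bt + D satisfy FG' = GF', whose coefficients of t⁴, t³, t² force y, B, D
to vanish in turn. -/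
theorem exists_linear_relation_of_pderiv (h2 : (2 : K) ≠ 0) (h3 : (3 : K) ≠ 0)
    {f g : MvPolynomial σ K} (hf : f.IsHomogeneous 3) (hg : g.IsHomogeneous 3) (hf0 : f ≠ 0)
    (h : ∀ i, f * pderiv i g = g * pderiv i f) : ∃ a : K, g = C a * f := by
  obtain ⟨v, hv⟩ : ∃ v, eval v f ≠ 0 := by
    by_contra! hcon
    refine hf0 (hf.eq_zero_of_forall_eval_eq_zero_of_le_card hcon (le_trans ?_
      (natCast_le_card_of_ne_zero h2 h3)))
    exact_mod_cast (by norm_num : 3 ≤ 5)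
  have hS2 : (2 : MvPolynomial σ K) ≠ 0 := by
    rw [← map_ofNat (C : K →+* MvPolynomial σ K) 2]; simpa using h2
  have hS3 : (3 : MvPolynomial σ K) ≠ 0 := by
    rw [← map_ofNat (C : K →+* MvPolynomial σ K) 3]; simpa using h3
  set a := eval v g * (eval v f)⁻¹
  refine ⟨a, ?_⟩
  rw [← sub_eq_zero]
  obtain ⟨f₁, hf₁⟩ : ∃ f₁, f₁ = C (eval v f)⁻¹ * f := ⟨_, rfl⟩
  obtain ⟨g₁, hg₁⟩ : ∃ g₁, g₁ = g - C a * f := ⟨_, rfl⟩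
  rw [← hg₁]
  have hf₁h : f₁.IsHomogeneous 3 := hf₁ ▸ hf.C_mul _
  have hg₁h : g₁.IsHomogeneous 3 := hg₁ ▸ hg.sub (hf.C_mul _)
  have hf₁v : eval v f₁ = 1 := by simp [hf₁, hv]
  have hg₁v : eval v g₁ = 0 := by simp [hg₁, a, hv]
  have h₁ : ∀ i, f₁ * pderiv i g₁ = g₁ * pderiv i f₁ := by
    intro i
    rw [hf₁, hg₁]
    simp only [map_sub, pderiv_C_mul]
    linear_combination C (eval v f)⁻¹ * h i
  have e₁ := lineShift_centre h3 hf₁h hf₁v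
  have e₂ := lineShift_centre_of_eval_eq_zero (f := f₁) hg₁h hg₁v
  refine lineShift_injective v (centre v f₁) ?_
  rw [map_zero]
  have hdiff : lineShift v (centre v f₁) f₁ *
      Polynomial.derivative (lineShift v (centre v f₁) g₁) =
      lineShift v (centre v f₁) g₁ * Polynomial.derivative (lineShift v (centre v f₁) f₁) := by
    have hd := fun p => derivation_algHom_eq_sum (lineShift v (centre v f₁))
      ((Polynomial.derivative' (R := MvPolynomial σ K)).restrictScalars K) p
    simp only [Derivation.restrictScalars_apply, Polynomial.derivative'_apply] at hd
    rw [hd f₁, hd g₁, Finset.mul_sum, Finset.mul_sum]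
    refine Finset.sum_congr rfl fun i _ => ?_
    rw [← mul_assoc, ← mul_assoc, ← map_mul, ← map_mul, h₁]
  generalize (∑ j, C (eval v (pderiv j g₁)) * X j) = y at e₂
  generalize lineShift v (centre v f₁) g₁ = G at *
  generalize lineShift v (centre v f₁) f₁ = F at *
  generalize G.coeff 1 = B at e₂
  generalize G.coeff 0 = D at e₂
  generalize F.coeff 1 = A at e₁
  generalize F.coeff 0 = E at e₁
  subst e₁ e₂
  simp only [Polynomial.derivative_add, Polynomial.derivative_mul, Polynomial.derivative_C,
    Polynomial.derivative_X_pow, Polynomial.derivative_X] at hdiff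
  have key : (.C (-y) * .X ^ 4 + .C (-2 * B) * .X ^ 3 + .C (A * y - 3 * D) * .X ^ 2
      + .C (2 * E * y) * .X + .C (E * B - A * D) : Polynomial (MvPolynomial σ K)) = 0 := by
    simp only [map_sub, map_mul, map_neg, map_ofNat]
    simp only [Nat.add_one_sub_one, Nat.cast_ofNat, map_ofNat, pow_one] at hdiff
    linear_combination hdiff
  have hc := fun k => congrArg (Polynomial.coeff · k) key
  have c4 := hc 4
  have c3 := hc 3
  have c2 := hc 2
  simp only [Polynomial.coeff_add, Polynomial.coeff_C_mul, Polynomial.coeff_X_pow,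
    Polynomial.coeff_X, Polynomial.coeff_C, Polynomial.coeff_zero] at c4 c3 c2
  norm_num at c4 c3 c2
  have hB : B = 0 := c3.resolve_left hS2
  rw [c4, mul_zero, zero_sub, neg_eq_zero] at c2
  have hD : D = 0 := (mul_eq_zero.mp c2).resolve_left hS3
  simp [c4, hB, hD]

end MvPolynomial

/-! ### Three cubic forms with dependent gradients. -/

namespace MvPolynomial

variable {K σ : Type*} [Field K] [Fintype σ]

theorem algebraicOverPair_lineShift (h2 : (2 : K) ≠ 0) (h3 : (3 : K) ≠ 0)
    {f g h : MvPolynomial σ K} (hf : f.IsHomogeneous 3) (hg : g.IsHomogeneous 3)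
    (hh : h.IsHomogeneous 3) {p q r : MvPolynomial σ K} (hne : p ≠ 0 ∨ q ≠ 0 ∨ r ≠ 0)
    (hdep : ∀ i, p * pderiv i f + q * pderiv i g + r * pderiv i h = 0)
    {v : σ → K} (hfv : eval v f = 1) (hgv : eval v g = 0) (hhv : eval v h = 0)
    (hg' : ∃ j, eval v (pderiv j g) ≠ 0) (hh' : ∀ j, eval v (pderiv j h) = 0) :
    AlgebraicOverPair K ({lineShift v (centre v f) f, lineShift v (centre v f) g,
      lineShift v (centre v f) h} : Set (Polynomial (MvPolynomial σ K))) := by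
  have hS3 : (3 : MvPolynomial σ K) ≠ 0 := by
    rw [← map_ofNat (C : K →+* MvPolynomial σ K) 3]; simpa using h3
  have hl := isHomogeneous_centre v f
  have e₁ := lineShift_centre h3 hf hfv
  have e₂ := lineShift_centre_of_eval_eq_zero (f := f) hg hgv
  have e₃ := lineShift_centre_of_eval_eq_zero (f := f) hh hhv
  simp only [hh', C_0, zero_mul, Finset.sum_const_zero, Polynomial.C_0, mul_zero, zero_add] at e₃
  have hy : (∑ j, C (eval v (pderiv j g)) * X j : MvPolynomial σ K).IsHomogeneous 1 :=
    isHomogeneous_sum_C_mul_X _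
  have hy0 : (∑ j, C (eval v (pderiv j g)) * X j : MvPolynomial σ K) ≠ 0 := by
    obtain ⟨j, hj⟩ := hg'
    exact fun h0 => hj (sum_C_mul_X_eq_zero h0 j)
  have hA := lineShift_coeff_isHomogeneous v hl hf (i := 1) (j := 2) rfl
  have hE := lineShift_coeff_isHomogeneous v hl hf (i := 0) (j := 3) rfl
  have hB := lineShift_coeff_isHomogeneous v hl hg (i := 1) (j := 2) rfl
  have hD := lineShift_coeff_isHomogeneous v hl hg (i := 0) (j := 3) rfl
  have hq := lineShift_coeff_isHomogeneous v hl hh (i := 1) (j := 2) rfl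
  have hc := lineShift_coeff_isHomogeneous v hl hh (i := 0) (j := 3) rfl
  have hinj := lineShift_injective v (centre v f)
  set φ := lineShift v (centre v f)
  have hne' : φ p ≠ 0 ∨ φ q ≠ 0 ∨ φ r ≠ 0 := by
    simpa only [ne_eq, map_eq_zero_iff φ hinj] using hne
  have hder : ∀ 𝔇 : Derivation K (Polynomial (MvPolynomial σ K)) (Polynomial (MvPolynomial σ K)),
      φ p * 𝔇 (φ f) + φ q * 𝔇 (φ g) + φ r * 𝔇 (φ h) = 0 := by
    intro 𝔇
    rw [derivation_algHom_eq_sum φ 𝔇 f, derivation_algHom_eq_sum φ 𝔇 g,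
      derivation_algHom_eq_sum φ 𝔇 h, Finset.mul_sum, Finset.mul_sum, Finset.mul_sum,
      ← Finset.sum_add_distrib, ← Finset.sum_add_distrib]
    refine Finset.sum_eq_zero fun i _ => ?_
    have := congrArg φ (hdep i)
    simp only [map_add, map_mul, map_zero] at this
    linear_combination 𝔇 (φ (X i)) * this
  have heuler : φ p * φ f + φ q * φ g + φ r * φ h = 0 := by
    rw [← map_mul, ← map_mul, ← map_mul, ← map_add, ← map_add, map_eq_zero_iff φ hinj]
    refine mul_left_cancel₀ hS3 ?_
    have hs : ∑ i, X i * (p * pderiv i f + q * pderiv i g + r * pderiv i h) = 0 :=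
      Finset.sum_eq_zero fun i _ => by rw [hdep i, mul_zero]
    have h₁ := hf.sum_X_mul_pderiv
    have h₂ := hg.sum_X_mul_pderiv
    have h₃ := hh.sum_X_mul_pderiv
    simp only [nsmul_eq_mul, Nat.cast_ofNat] at h₁ h₂ h₃
    have hs' : p * ∑ i, X i * pderiv i f + q * ∑ i, X i * pderiv i g
        + r * ∑ i, X i * pderiv i h = 0 := by
      rw [← hs, Finset.mul_sum, Finset.mul_sum, Finset.mul_sum, ← Finset.sum_add_distrib,
        ← Finset.sum_add_distrib]
      exact Finset.sum_congr rfl fun i _ => by ring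
    rw [h₁, h₂, h₃] at hs'
    linear_combination hs'
  -- The ∂/∂t column of the determinant; Euler's relation supplies the identity column, and 𝔇 acting
  -- on coefficients the third.
  have hX := hder ((Polynomial.derivative' (R := MvPolynomial σ K)).restrictScalars K)
  simp only [Derivation.restrictScalars_apply, Polynomial.derivative'_apply] at hX
  generalize (∑ j, C (eval v (pderiv j g)) * X j) = y at *
  generalize φ f = F at *
  generalize φ g = G at *
  generalize φ h = H at *
  generalize F.coeff 1 = A at *
  generalize F.coeff 0 = E at *
  generalize G.coeff 1 = B at *
  generalize G.coeff 0 = D at *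
  generalize H.coeff 1 = q' at *
  generalize H.coeff 0 = c at *
  subst e₁ e₂ e₃
  refine algebraicOverPair_of_det_eq_zero h2 h3 hy hy0 hA hB hE hD hq hc fun 𝔇 h𝔇 => ?_
  have h₃ := hder 𝔇.onCoeffs
  have hdet := det_eq_zero_of_dependent_rows hne' hX heuler h₃
  simp only [map_add, Derivation.leibniz, Derivation.leibniz_pow, Derivation.onCoeffs_X,
    Derivation.onCoeffs_C, h𝔇, smul_eq_mul, smul_zero, mul_zero, Polynomial.C_0, add_zero,
    zero_add, Polynomial.derivative_mul, Polynomial.derivative_X_pow, Polynomial.derivative_X,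
    Polynomial.derivative_C, Nat.add_one_sub_one, Nat.cast_ofNat, map_ofNat, pow_one,
    one_mul] at hdet
  linear_combination hdet

/-- Triangular combinations over K normalise the values and gradients of the three forms at v;
algebraicity over the pair passes back to f, g, h. -/
theorem exists_algHom_algebraicOverPair_of_eval_ne_zero (h2 : (2 : K) ≠ 0) (h3 : (3 : K) ≠ 0)
    {f g h : MvPolynomial σ K} (hf : f.IsHomogeneous 3) (hg : g.IsHomogeneous 3)
    (hh : h.IsHomogeneous 3) {p q r : MvPolynomial σ K} (hne : p ≠ 0 ∨ q ≠ 0 ∨ r ≠ 0)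
    (hdep : ∀ i, p * pderiv i f + q * pderiv i g + r * pderiv i h = 0)
    {v : σ → K} (hfv : eval v f ≠ 0) {j : σ}
    (hj : eval v (f * pderiv j g - g * pderiv j f) ≠ 0) :
    ∃ φ : MvPolynomial σ K →ₐ[K] Polynomial (MvPolynomial σ K), Function.Injective φ ∧
      AlgebraicOverPair K {φ f, φ g, φ h} := by
  have hS3 : (3 : MvPolynomial σ K) ≠ 0 := by
    rw [← map_ofNat (C : K →+* MvPolynomial σ K) 3]; simpa using h3
  set u := eval v f
  obtain ⟨a, ha⟩ : ∃ a, a = eval v g := ⟨_, rfl⟩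
  obtain ⟨b, hb⟩ : ∃ b, b = eval v h := ⟨_, rfl⟩
  obtain ⟨f₁, hf₁⟩ : ∃ f₁, f₁ = C u⁻¹ * f := ⟨_, rfl⟩
  have hff : f = C u * f₁ := by
    rw [hf₁, ← mul_assoc, ← C_mul, mul_inv_cancel₀ hfv, C_1, one_mul]
  have hf₁v : eval v f₁ = 1 := by simp [hf₁, u, hfv]
  obtain ⟨g₁, hg₁⟩ : ∃ g₁, g₁ = g - C a * f₁ := ⟨_, rfl⟩
  have hg₁v : eval v g₁ = 0 := by simp [hg₁, ha, hf₁v]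
  obtain ⟨h₀, hh₀⟩ : ∃ h₀, h₀ = h - C b * f₁ := ⟨_, rfl⟩
  have hh₀v : eval v h₀ = 0 := by simp [hh₀, hb, hf₁v]
  have hg₁j : eval v (pderiv j g₁) ≠ 0 := by
    intro h0
    apply hj
    obtain rfl : g = g₁ + C a * f₁ := by rw [hg₁]; ring
    rw [hff]
    simp only [map_sub, map_add, map_mul, pderiv_C_mul, hf₁v, hg₁v, h0, eval_C]
    ring
  -- This s makes ∂ⱼh₁ vanish at v.
  obtain ⟨s, hs⟩ : ∃ s, s = eval v (pderiv j h₀) * (eval v (pderiv j g₁))⁻¹ := ⟨_, rfl⟩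
  obtain ⟨h₁, hh₁⟩ : ∃ h₁, h₁ = h₀ - C s * g₁ := ⟨_, rfl⟩
  have hgg : g = g₁ + C a * f₁ := by rw [hg₁]; ring
  have hhh : h = h₁ + C s * g₁ + C b * f₁ := by rw [hh₁, hh₀]; ring
  have hf₁h : f₁.IsHomogeneous 3 := hf₁ ▸ hf.C_mul _
  have hg₁h : g₁.IsHomogeneous 3 := hg₁ ▸ hg.sub (hf₁h.C_mul _)
  have hh₀h : h₀.IsHomogeneous 3 := hh₀ ▸ hh.sub (hf₁h.C_mul _)
  have hh₁h : h₁.IsHomogeneous 3 := hh₁ ▸ hh₀h.sub (hg₁h.C_mul _)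
  have hh₁v : eval v h₁ = 0 := by simp [hh₁, hh₀v, hg₁v]
  have hCu : C u ≠ (0 : MvPolynomial σ K) := by rwa [ne_eq, C_eq_zero]
  have hne₁ : p * C u + q * C a + r * C b ≠ 0 ∨ q + r * C s ≠ 0 ∨ r ≠ 0 := by
    by_contra! hcon
    obtain ⟨hc₁, hc₂, rfl⟩ := hcon
    rw [zero_mul, add_zero] at hc₂
    subst hc₂
    have : p = 0 := by simpa [hCu, hfv] using hc₁
    simp [this] at hne
  have hdep₁ : ∀ i, (p * C u + q * C a + r * C b) * pderiv i f₁ + (q + r * C s) * pderiv i g₁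
      + r * pderiv i h₁ = 0 := by
    intro i
    have := hdep i
    rw [hff, hgg, hhh] at this
    simp only [map_add, pderiv_C_mul] at this
    linear_combination this
  have hdep_euler : (p * C u + q * C a + r * C b) * f₁ + (q + r * C s) * g₁ + r * h₁ = 0 := by
    refine mul_left_cancel₀ hS3 ?_
    have e₁ := hf₁h.sum_X_mul_pderiv
    have e₂ := hg₁h.sum_X_mul_pderiv
    have e₃ := hh₁h.sum_X_mul_pderiv
    simp only [nsmul_eq_mul, Nat.cast_ofNat] at e₁ e₂ e₃
    have hs' : (p * C u + q * C a + r * C b) * ∑ i, X i * pderiv i f₁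
        + (q + r * C s) * ∑ i, X i * pderiv i g₁ + r * ∑ i, X i * pderiv i h₁ = 0 := by
      rw [Finset.mul_sum, Finset.mul_sum, Finset.mul_sum, ← Finset.sum_add_distrib,
        ← Finset.sum_add_distrib]
      exact Finset.sum_eq_zero fun i _ => by linear_combination X i * hdep₁ i
    rw [e₁, e₂, e₃] at hs'
    linear_combination hs'
  have hh₁j : eval v (pderiv j h₁) = 0 := by
    rw [hh₁]
    simp [hs, hg₁j]
  -- At v the determinant of values, ∂ⱼ and ∂ₖ of f₁, g₁, h₁ is triangular with diagonal 1, ∂ⱼg₁(v),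
  -- ∂ₖh₁(v).
  have hh₁' : ∀ k, eval v (pderiv k h₁) = 0 := by
    intro k
    have := congrArg (eval v)
      (det_eq_zero_of_dependent_rows hne₁ hdep_euler (hdep₁ j) (hdep₁ k))
    simp only [map_add, map_sub, map_mul, hf₁v, hg₁v, hh₁v, hh₁j, map_zero] at this
    have h0 : eval v (pderiv j g₁) * eval v (pderiv k h₁) = 0 := by linear_combination this
    exact (mul_eq_zero.mp h0).resolve_left hg₁j
  obtain ⟨x, y, hxy⟩ := algebraicOverPair_lineShift h2 h3 hf₁h hg₁h hh₁h hne₁ hdep₁ hf₁v hg₁v hh₁v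
    ⟨j, hg₁j⟩ hh₁'
  refine ⟨_, lineShift_injective v (centre v f₁), x, y, ?_⟩
  generalize lineShift v (centre v f₁) = φ at *
  have hC : ∀ k : K, IsAlgebraic (Algebra.adjoin K {x, y}) (φ (C k)) := by
    intro k
    rw [← algebraMap_eq, AlgHom.commutes]
    exact isAlgebraic_of_mem (Subalgebra.algebraMap_mem _ k)
  have af := hxy _ (Set.mem_insert _ _)
  have ag := hxy _ (Set.mem_insert_of_mem _ (Set.mem_insert _ _))
  have ah := hxy _ (Set.mem_insert_of_mem _ (Set.mem_insert_of_mem _ rfl))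
  rintro z (rfl | rfl | rfl)
  · rw [hff, map_mul]; exact (hC _).mul af
  · rw [hgg, map_add, map_mul]; exact ag.add ((hC _).mul af)
  · rw [hhh, map_add, map_add, map_mul, map_mul]
    exact (ah.add ((hC _).mul ag)).add ((hC _).mul af)

end MvPolynomial

/-- In the matroid of algebraic independence, the closure of two elements has rank at most 2. -/
theorem not_algebraicIndependent_of_isAlgebraic_adjoin_pair {K R : Type*} [Field K] [CommRing R]
    [IsDomain R] [Algebra K R] {w : Fin 3 → R} {a b : R}
    (h : ∀ i, IsAlgebraic (Algebra.adjoin K {a, b}) (w i)) : ¬ AlgebraicIndependent K w := by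
  intro hw
  have hI : (AlgebraicIndependent.matroid K R).Indep (Set.range w) :=
    AlgebraicIndependent.matroid_indep_iff.mpr hw.coe_range
  have hsub : Set.range w ⊆ (AlgebraicIndependent.matroid K R).closure {a, b} := by
    rw [AlgebraicIndependent.matroid_closure_eq]
    rintro _ ⟨i, rfl⟩
    exact h i
  have h1 := hI.encard_le_eRk_of_subset hsub
  rw [Matroid.eRk_closure_eq] at h1
  have h2 := h1.trans (Matroid.eRk_le_encard _ _)
  have h3 : (Set.range w).encard = 3 := by
    rw [← Set.image_univ, hw.injective.encard_image, Set.encard_univ]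
    simp
  have h4 := h2.trans (Set.encard_insert_le {b} a)
  rw [h3, Set.encard_singleton] at h4
  exact absurd h4 (by norm_num)

namespace MvPolynomial

variable {K σ : Type*} [Field K] [Fintype σ]

theorem not_algebraicIndependent_of_pderiv_dependent (h2 : (2 : K) ≠ 0) (h3 : (3 : K) ≠ 0)
    {f g h : MvPolynomial σ K} (hf : f.IsHomogeneous 3) (hg : g.IsHomogeneous 3)
    (hh : h.IsHomogeneous 3) {p q r : MvPolynomial σ K} (hne : p ≠ 0 ∨ q ≠ 0 ∨ r ≠ 0)
    (hdep : ∀ i, p * pderiv i f + q * pderiv i g + r * pderiv i h = 0) :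
    ¬ AlgebraicIndependent K ![f, g, h] := by
  intro hind
  have hf0 : f ≠ 0 := hind.ne_zero 0
  by_cases hpair : ∀ j, f * pderiv j g = g * pderiv j f
  · obtain ⟨a, rfl⟩ := exists_linear_relation_of_pderiv h2 h3 hf hg hf0 hpair
    refine not_algebraicIndependent_of_isAlgebraic_adjoin_pair (a := f) (b := h) (fun i => ?_) hind
    refine isAlgebraic_of_mem ?_
    fin_cases i
    · exact Algebra.subset_adjoin (by simp)
    · exact Subalgebra.mul_mem _ (Subalgebra.algebraMap_mem _ a) (Algebra.subset_adjoin (by simp))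
    · exact Algebra.subset_adjoin (by simp)
  push Not at hpair
  obtain ⟨j, hj⟩ := hpair
  have hhom : (f * pderiv j g - g * pderiv j f).IsHomogeneous 5 :=
    (hf.mul hg.pderiv).sub (hg.mul hf.pderiv)
  obtain ⟨v, hv⟩ : ∃ v, eval v (f * pderiv j g - g * pderiv j f) ≠ 0 := by
    by_contra! hcon
    exact sub_ne_zero.mpr hj (hhom.eq_zero_of_forall_eval_eq_zero_of_le_card hcon
      (natCast_le_card_of_ne_zero h2 h3))
  obtain ⟨φ, hφ, a, b, hab⟩ : ∃ φ : MvPolynomial σ K →ₐ[K] Polynomial (MvPolynomial σ K),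
      Function.Injective φ ∧ AlgebraicOverPair K {φ f, φ g, φ h} := by
    -- If f(v) = 0 then g(v) ≠ 0, and f and g exchange roles.
    by_cases hfv : eval v f = 0
    · have hgv : eval v g ≠ 0 := by
        intro hgv; apply hv; simp [hfv, hgv]
      obtain ⟨φ, hφ, H⟩ := exists_algHom_algebraicOverPair_of_eval_ne_zero h2 h3 hg hf hh
        (p := q) (q := p) (r := r) (by tauto) (fun i => by linear_combination hdep i) hgv (j := j)
        (fun h0 => hv (by rw [← neg_sub, map_neg, h0, neg_zero]))
      exact ⟨φ, hφ, by rwa [Set.insert_comm]⟩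
    · exact exists_algHom_algebraicOverPair_of_eval_ne_zero h2 h3 hf hg hh hne hdep hfv hv
  refine not_algebraicIndependent_of_isAlgebraic_adjoin_pair (w := φ ∘ ![f, g, h]) (a := a) (b := b)
    (fun i => ?_) (hind.map' hφ)
  fin_cases i
  · exact hab _ (by simp)
  · exact hab _ (by simp)
  · exact hab _ (by simp)

end MvPolynomial

/-! ### Algebraic independence of cubic forms against linear independence of gradients. -/

namespace MvPolynomial

variable {K σ : Type*} [Field K]

theorem IsHomogeneous.transcendental {f : MvPolynomial σ K} {d : ℕ} (hf : f.IsHomogeneous d)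
    (hd : d ≠ 0) (hf0 : f ≠ 0) : Transcendental K f := by
  intro halg
  obtain ⟨r, hr, g, hg⟩ := halg.exists_nonzero_dvd (mem_nonZeroDivisors_of_ne_zero hf0)
  have hg0 : g ≠ 0 := by
    rintro rfl
    rw [mul_zero, algebraMap_eq, C_eq_zero] at hg
    exact hr hg
  have := congrArg MvPolynomial.totalDegree hg
  rw [totalDegree_mul_of_isDomain hf0 hg0, algebraMap_eq, totalDegree_C, hf.totalDegree hf0] at this
  omega

/-- Components of P of different degrees i land in different degrees ei, so each of them is itself a
relation. -/
theorem exists_isHomogeneous_aeval_eq_zero {ι : Type*} {w : ι → MvPolynomial σ K} {e : ℕ}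
    (he : e ≠ 0) (hw : ∀ i, (w i).IsHomogeneous e) (h : ¬ AlgebraicIndependent K w) :
    ∃ (P : MvPolynomial ι K) (d : ℕ), P ≠ 0 ∧ P.IsHomogeneous d ∧ aeval w P = 0 := by
  rw [algebraicIndependent_iff] at h
  push Not at h
  obtain ⟨P, hP, hP0⟩ := h
  obtain ⟨d, hd⟩ : ∃ d, homogeneousComponent d P ≠ 0 := by
    by_contra! hcon
    exact hP0 (by rw [← sum_homogeneousComponent P]; exact Finset.sum_eq_zero fun i _ => hcon i)
  refine ⟨_, d, hd, homogeneousComponent_isHomogeneous d P, ?_⟩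
  have h1 := congrArg (homogeneousComponent (e * d)) hP
  rw [map_zero] at h1
  conv_lhs at h1 => rw [← sum_homogeneousComponent P, map_sum, map_sum]
  have h2 : ∀ i, homogeneousComponent (e * d) (aeval w (homogeneousComponent i P)) =
      if i = d then aeval w (homogeneousComponent d P) else 0 := by
    intro i
    have h3 : aeval w (homogeneousComponent i P) ∈ homogeneousSubmodule σ K (e * i) :=
      (homogeneousComponent_isHomogeneous i P).aeval w hw
    rw [homogeneousComponent_of_mem h3]
    by_cases hi : i = d
    · subst hi; simp
    · rw [if_neg hi, if_neg]
      exact fun h4 => hi (Nat.eq_of_mul_eq_mul_left (Nat.pos_of_ne_zero he) h4).symm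
  rw [Finset.sum_congr rfl fun i _ => h2 i, Finset.sum_ite_eq'] at h1
  split_ifs at h1 with hmem
  · exact h1
  · refine absurd (homogeneousComponent_eq_zero d P ?_) hd
    rw [Finset.mem_range] at hmem; omega

theorem isAlgebraic_div_of_aeval_eq_zero {L : Type*} [Field L] [Algebra K L] {f g : L}
    (hg : g ≠ 0) {P : MvPolynomial (Fin 2) K} {d : ℕ} (hP0 : P ≠ 0) (hP : P.IsHomogeneous d)
    (h : aeval ![f, g] P = 0) : IsAlgebraic K (f / g) := by
  have hdeg : ∀ m ∈ P.support, m 0 + m 1 = d := by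
    intro m hm
    have := hP (mem_support_iff.mp hm)
    rw [← this]
    simp [Finsupp.weight_apply, Finsupp.sum_fintype]
  -- The dehomogenisation P(T, 1); no terms merge, because the first exponent determines the second.
  refine ⟨∑ m ∈ P.support, Polynomial.monomial (m 0) (P.coeff m), fun h0 => ?_, ?_⟩
  · obtain ⟨m, hm⟩ := support_nonempty.mpr hP0
    have h1 := congrArg (Polynomial.coeff · (m 0)) h0
    simp only [Polynomial.finsetSum_coeff, Polynomial.coeff_monomial, Polynomial.coeff_zero] at h1
    rw [Finset.sum_eq_single_of_mem m hm] at h1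
    · simp only [if_true] at h1
      exact mem_support_iff.mp hm h1
    · intro m' hm' hne
      refine if_neg fun h00 => hne ?_
      have e1 := hdeg m hm
      have e2 := hdeg m' hm'
      ext i
      fin_cases i
      · exact h00
      · change m' 1 = m 1
        omega
  · rw [map_sum]
    refine mul_left_cancel₀ (pow_ne_zero d hg) ?_
    rw [mul_zero, ← h, aeval_def, eval₂_eq', Finset.mul_sum]
    refine Finset.sum_congr rfl fun m hm => ?_
    rw [Polynomial.aeval_monomial, Fin.prod_univ_two, ← hdeg m hm]
    simp only [Matrix.cons_val_zero, Matrix.cons_val_one]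
    rw [div_pow, pow_add]
    field_simp

/-- A homogeneous relation would make f/g algebraic over K, hence integral over K[x], hence a
polynomial, which must have degree 0. -/
theorem algebraicIndependent_pair_of_isHomogeneous {f g : MvPolynomial σ K} {e : ℕ} (he : e ≠ 0)
    (hf : f.IsHomogeneous e) (hg : g.IsHomogeneous e) (hg0 : g ≠ 0)
    (h : ∀ c : K, f ≠ C c * g) : AlgebraicIndependent K ![f, g] := by
  by_contra hcon
  obtain ⟨P, d, hP0, hP, hPz⟩ := exists_isHomogeneous_aeval_eq_zero he
    (fun i => by fin_cases i <;> assumption) hcon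
  set F := FractionRing (MvPolynomial σ K)
  have hinj : Function.Injective (algebraMap (MvPolynomial σ K) F) := IsFractionRing.injective _ _
  have hgF : algebraMap _ F g ≠ 0 := by rwa [ne_eq, map_eq_zero_iff _ hinj]
  have hz : aeval ![algebraMap _ F f, algebraMap _ F g] P = 0 := by
    have h1 := congrArg (algebraMap (MvPolynomial σ K) F) hPz
    rw [map_zero, ← aeval_algebraMap_apply] at h1
    rw [← h1]
    congr 2
    ext i
    fin_cases i <;> rfl
  have halg := (isAlgebraic_div_of_aeval_eq_zero hgF hP0 hP hz).isIntegral
  obtain ⟨s, hs⟩ := IsIntegrallyClosed.isIntegral_iff.mp (halg.tower_top (A := MvPolynomial σ K))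
  rw [eq_div_iff hgF, ← map_mul] at hs
  have hs' := hinj hs
  have hsh : s.IsHomogeneous 0 := hg.of_mul_left hg0 (d := 0) (by rwa [mul_comm, hs'])
  obtain ⟨c, rfl⟩ := hsh.eq_C
  exact h c hs'.symm

variable [Fintype σ]

theorem linearIndependent_pderiv_of_algebraicIndependent (h2 : (2 : K) ≠ 0) (h3 : (3 : K) ≠ 0)
    {k : ℕ} (hk : k ≤ 3) {w : Fin k → MvPolynomial σ K} (hw : ∀ i, (w i).IsHomogeneous 3)
    (hind : AlgebraicIndependent K w) :
    LinearIndependent (MvPolynomial σ K) fun i j => pderiv j (w i) := by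
  by_contra hcon
  rw [Fintype.not_linearIndependent_iff] at hcon
  obtain ⟨c, hc, i₀, hi₀⟩ := hcon
  have hc' : ∀ j, ∑ i, c i * pderiv j (w i) = 0 := by
    intro j
    simpa [Finset.sum_apply] using congrFun hc j
  have hS3 : (3 : MvPolynomial σ K) ≠ 0 := by
    rw [← map_ofNat (C : K →+* MvPolynomial σ K) 3]; simpa using h3
  have heuler : ∑ i, c i * w i = 0 := by
    refine mul_left_cancel₀ hS3 ?_
    have hs : ∑ j, X j * ∑ i, c i * pderiv j (w i) = 0 :=
      Finset.sum_eq_zero fun j _ => by rw [hc' j, mul_zero]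
    simp only [Finset.mul_sum] at hs
    rw [Finset.sum_comm] at hs
    rw [mul_zero, ← hs, Finset.mul_sum]
    refine Finset.sum_congr rfl fun i _ => ?_
    have := (hw i).sum_X_mul_pderiv
    rw [nsmul_eq_mul, Nat.cast_ofNat] at this
    rw [mul_left_comm, ← this, Finset.mul_sum]
    exact Finset.sum_congr rfl fun j _ => by ring
  match k, hk with
  | 0, _ => exact i₀.elim0
  | 1, _ =>
    rw [Fin.sum_univ_one] at heuler
    obtain rfl := Subsingleton.elim i₀ 0
    exact hind.ne_zero 0 ((mul_eq_zero.mp heuler).resolve_left hi₀)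
  | 2, _ =>
    simp only [Fin.sum_univ_two] at heuler hc'
    -- Eliminating between the gradient relation and its Euler consequence gives w₀ ∂ⱼw₁ = w₁ ∂ⱼw₀.
    obtain ⟨a, ha⟩ := exists_linear_relation_of_pderiv h2 h3 (hw 0) (hw 1) (hind.ne_zero 0)
      (fun j => by
        have e := hc' j
        by_cases h0 : c 0 = 0
        · have h1 : c 1 ≠ 0 := by
            fin_cases i₀
            · exact absurd h0 hi₀
            · exact hi₀
          refine mul_left_cancel₀ h1 ?_
          linear_combination w 0 * e - pderiv j (w 0) * heuler
        · refine mul_left_cancel₀ h0 ?_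
          linear_combination pderiv j (w 1) * heuler - w 1 * e)
    have h1 := algebraicIndependent_iff.mp hind (X 1 - C a * X 0) (by simp [ha, algebraMap_eq])
    simpa using congrArg (aeval ![(0 : K), 1]) h1
  | 3, _ =>
    have hww : w = ![w 0, w 1, w 2] := by ext1 i; fin_cases i <;> rfl
    refine not_algebraicIndependent_of_pderiv_dependent h2 h3 (hw 0) (hw 1) (hw 2)
      (p := c 0) (q := c 1) (r := c 2) ?_ (fun j => ?_) (hww ▸ hind)
    · fin_cases i₀
      · exact Or.inl hi₀
      · exact Or.inr (Or.inl hi₀)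
      · exact Or.inr (Or.inr hi₀)
    · simpa [Fin.sum_univ_three] using hc' j

omit [Fintype σ] in
theorem algebraicIndependent_of_linearIndependent_pderiv
    {k : ℕ} (hk : k ≤ 2) {w : Fin k → MvPolynomial σ K} (hw : ∀ i, (w i).IsHomogeneous 3)
    (hind : LinearIndependent (MvPolynomial σ K) fun i j => pderiv j (w i)) :
    AlgebraicIndependent K w := by
  have hne : ∀ i, w i ≠ 0 := by
    intro i h0
    exact hind.ne_zero i (by ext1 j; simp [h0])
  match k, hk with
  | 0, _ =>
    exact (algebraicIndependent_empty_type_iff).mpr (algebraMap K (MvPolynomial σ K)).injective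
  | 1, _ =>
    rw [algebraicIndependent_unique_type_iff]
    exact (hw _).transcendental (by norm_num) (hne _)
  | 2, _ =>
    have hww : w = ![w 0, w 1] := by ext1 i; fin_cases i <;> rfl
    rw [hww]
    refine algebraicIndependent_pair_of_isHomogeneous (e := 3) (by norm_num) (hw 0) (hw 1) (hne 1)
      fun c hc => ?_
    have h1 := Fintype.linearIndependent_iff.mp hind ![1, -C c] (by
      ext1 j
      simp [Fin.sum_univ_two, hc]) 0
    simp at h1

end MvPolynomial

/-! ### Rank and transcendence degree measured by independent subfamilies; conclusion. -/

theorem natCast_le_trdeg_adjoin_range_iff {K F ι : Type*} [Field K] [Field F] [Algebra K F]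
    (a : ι → F) (k : ℕ) :
    (k : Cardinal) ≤ Algebra.trdeg K (IntermediateField.adjoin K (Set.range a)) ↔
      ∃ e : Fin k → ι, AlgebraicIndependent K (a ∘ e) := by
  constructor
  · set s := Set.range a
    set A := Algebra.adjoin K s
    have htr : Algebra.trdeg K (IntermediateField.adjoin K s) = Algebra.trdeg K A := by
      open scoped IntermediateField.algebraAdjoinAdjoin in
      have h := trdeg_add_eq K A (A := IntermediateField.adjoin K s)
      rw [trdeg_eq_zero (R := A), add_zero] at h
      exact h.symm
    rw [htr]
    intro hk
    set s' : Set A := Subtype.val ⁻¹' s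
    have htop : Algebra.adjoin K s' = ⊤ := Algebra.adjoin_adjoin_coe_preimage
    have : Algebra.IsAlgebraic (Algebra.adjoin K s') A :=
      ⟨fun x => isAlgebraic_of_mem (htop ▸ Algebra.mem_top)⟩
    -- A transcendence basis can be chosen among the generators themselves.
    obtain ⟨t, hts, ht⟩ := exists_isTranscendenceBasis_subset (R := K) s'
    rw [← ht.cardinalMk_eq_trdeg] at hk
    obtain ⟨g⟩ : Nonempty (Fin k ↪ t) := by
      rw [← Cardinal.lift_mk_le']
      simpa using hk
    have hg : ∀ i, ∃ j, a j = ((g i : A) : F) := fun i => hts (g i).2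
    choose e he using hg
    refine ⟨e, ?_⟩
    have h1 := (ht.1.comp g g.injective).map' (f := A.val) Subtype.val_injective
    convert h1 using 1
    ext1 i
    exact he i
  · rintro ⟨e, he⟩
    have hmem : ∀ i, a (e i) ∈ IntermediateField.adjoin K (Set.range a) := fun i =>
      IntermediateField.subset_adjoin _ _ ⟨e i, rfl⟩
    have h1 : AlgebraicIndependent K
        fun i => (⟨a (e i), hmem i⟩ : IntermediateField.adjoin K (Set.range a)) :=
      ((IntermediateField.adjoin K (Set.range a)).val.algebraicIndependent_iff
        Subtype.val_injective).mp he
    simpa using h1.lift_cardinalMk_le_trdeg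

theorem natCast_le_trdeg_fieldGeneratedBy_iff {K : Type*} [Field K] {m n : ℕ}
    (H : Fin m → MvPolynomial (Fin n) K) (k : ℕ) :
    (k : Cardinal) ≤ Algebra.trdeg K (fieldGeneratedBy H) ↔
      ∃ e : Fin k → Fin m, AlgebraicIndependent K (H ∘ e) := by
  rw [fieldGeneratedBy, natCast_le_trdeg_adjoin_range_iff]
  refine exists_congr fun e => ?_
  exact AlgHom.algebraicIndependent_iff (IsScalarTower.toAlgHom K (MvPolynomial (Fin n) K)
    (FractionRing (MvPolynomial (Fin n) K))) (IsFractionRing.injective _ _)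

theorem Matrix.natCast_le_rank_iff {F m n : Type*} [Field F] [Fintype m] [Fintype n]
    (M : Matrix m n F) (k : ℕ) :
    k ≤ M.rank ↔ ∃ e : Fin k → m, LinearIndependent F fun i => M.row (e i) := by
  rw [M.rank_eq_finrank_span_row]
  constructor
  · intro hk
    obtain ⟨f, hf, -, hli⟩ := Submodule.exists_fun_fin_finrank_span_eq F (Set.range M.row)
    choose e he using hf
    obtain rfl : (fun i => M.row (e i)) = f := funext he
    exact ⟨e ∘ Fin.castLE hk, hli.comp (Fin.castLE hk) (Fin.castLE_injective hk)⟩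
  · rintro ⟨e, he⟩
    have h1 := linearIndependent_iff_card_eq_finrank_span.mp he
    rw [Fintype.card_fin] at h1
    rw [h1]
    exact Submodule.finrank_mono (Submodule.span_mono (Set.range_comp_subset_range e M.row))

theorem natCast_le_jacobianRank_iff {K : Type*} [Field K] {m n : ℕ}
    (H : Fin m → MvPolynomial (Fin n) K) (k : ℕ) :
    k ≤ jacobianRank H ↔
      ∃ e : Fin k → Fin m, LinearIndependent (MvPolynomial (Fin n) K)
        fun i j => MvPolynomial.pderiv j (H (e i)) := by
  rw [jacobianRank, Matrix.natCast_le_rank_iff]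
  refine exists_congr fun e => ?_
  rw [← LinearIndependent.iff_fractionRing (MvPolynomial (Fin n) K)
    (FractionRing (MvPolynomial (Fin n) K))]
  refine LinearMap.linearIndependent_iff_of_injOn
    (v := fun i j => MvPolynomial.pderiv j (H (e i)))
    ((Algebra.linearMap (MvPolynomial (Fin n) K)
      (FractionRing (MvPolynomial (Fin n) K))).compLeft (Fin n)) ?_
  intro x _ y _ hxy
  ext1 j
  exact IsFractionRing.injective _ _ (congrFun hxy j)

theorem theorem2p5 {K : Type*} [Field K] (hK2 : ringChar K ≠ 2) (hK3 : ringChar K ≠ 3)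
    (m n : ℕ) (H : Fin m → MvPolynomial (Fin n) K)
    (hH : IsCubicHomogeneous H) (hrk : jacobianRank H ≤ 2) :
    (jacobianRank H : Cardinal) = Algebra.trdeg K (fieldGeneratedBy H) := by
  have h2 : (2 : K) ≠ 0 := Ring.two_ne_zero hK2
  have h3 : (3 : K) ≠ 0 := by
    intro h
    have h' : ringChar K ∣ 3 := ringChar.dvd (by exact_mod_cast h)
    rcases (Nat.dvd_prime Nat.prime_three).mp h' with h1 | h1
    · have := (ringChar.spec K 1).mpr (h1 ▸ dvd_rfl)
      simp at this
    · exact hK3 h1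
  refine le_antisymm ?_ ?_
  · obtain ⟨e, he⟩ := (natCast_le_jacobianRank_iff H _).mp le_rfl
    exact (natCast_le_trdeg_fieldGeneratedBy_iff H _).mpr
      ⟨e, MvPolynomial.algebraicIndependent_of_linearIndependent_pderiv hrk (fun i => hH (e i)) he⟩
  -- Otherwise some rank + 1 ≤ 3 of the forms are algebraically independent, so their gradients are
  -- linearly independent, exceeding the rank.
  · by_contra! hlt
    have hle : ((jacobianRank H + 1 : ℕ) : Cardinal) ≤ Algebra.trdeg K (fieldGeneratedBy H) := by
      rw [Nat.cast_add_one]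
      exact Cardinal.natCast_add_one_le_iff.mpr hlt
    obtain ⟨e, he⟩ := (natCast_le_trdeg_fieldGeneratedBy_iff H _).mp hle
    have := (natCast_le_jacobianRank_iff H _).mpr
      ⟨e, MvPolynomial.linearIndependent_pderiv_of_algebraicIndependent h2 h3 (by omega)
        (fun i => hH (e i)) he⟩
    omega
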